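/- Oriented knot diagrams (and link diagrams) are considered up to planar isotopy. An oriented Reidemeister move replaces, in either direction, one diagram inside a disk (its localized disk) by another one with the same boundary, and leaves the diagram unchanged outside the disk. There are 16 of them. Type 1 (a strand gets a kink): $\Omega1a$ has a positive crossing and a clockwise loop, $\Omega1b$ a positive crossing and a counterclockwise loop, $\Omega1c$ a negative crossing and a clockwise loop, $\Omega1d$ a negative crossing and a counterclockwise loop. Type 2 (one of two strands is pushed over the other, which creates a bigon): in $\Omega2a$ and $\Omega2b$ the two strands run in parallel and meet first a positive and then a negative crossing for $\Omega2a$, and first a negative and then a positive crossing for $\Omega2b$; in $\Omega2c$ and $\Omega2d$ the strands are antiparallel, and the bigon is oriented counterclockwise for $\Omega2c$ and clockwise for $\Omega2d$. Type 3 (of three pairwise crossing strands, a top, a middle and a bottom one, one is moved across the crossing of the other two): the move is determined by the signs of the three crossings (top/middle, top/bottom, middle/bottom), which are $(+,-,+)$ for $\Omega3a$, $(+,+,+)$ for $\Omega3b$, $(-,-,+)$ for $\Omega3c$, $(+,+,-)$ for $\Omega3d$, $(-,+,+)$ for $\Omega3e$, $(+,-,-)$ for $\Omega3f$, $(-,-,-)$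 for $\Omega3g$ and $(-,+,-)$ for $\Omega3h$. (The triangle is coherently oriented exactly for $\Omega3a$ and $\Omega3h$.) A set $S$ of oriented Reidemeister moves is called generating if each of the 16 oriented Reidemeister moves can be realized by a finite sequence of planar isotopies and moves from $S$ (in either direction), all applied inside the localized disk of that move and fixing its boundary. Let $$\begin{aligned}\mathcal A=\{&\{\Omega1a,\Omega1c,\Omega2a,\Omega3a\},\{\Omega1a,\Omega1c,\Omega2b,\Omega3a\},\{\Omega1b,\Omega1d,\Omega2a,\Omega3a\},\\&\{\Omega1b,\Omega1d,\Omega2b,\Omega3a\},\{\Omega1a,\Omega1b,\Omega2a,\Omega3a\},\{\Omega1a,\Omega1b,\Omega2b,\Omega3a\}\},\\ \mathcal H=\{&\{\Omega1a,\Omega1c,\Omega2a,\Omega3h\},\{\Omega1a,\Omega1c,\Omega2b,\Omega3h\},\{\Omega1b,\Omega1d,\Omega2a,\Omega3h\},\\&\{\Omega1b,\Omega1d,\Omega2b,\Omega3h\},\{\Omega1c,\Omega1d,\Omega2a,\Omega3h\},\{\Omega1c,\Omega1d,\Omega2b,\Omega3h\}\}.\end{aligned}$$ Theorem. Every $X\in\mathcal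 A\cup\mathcal H$ is a generating set for all oriented Reidemeister moves for knot diagrams. -/

import Mathlib

/-! # Oriented knot diagrams in a disk, planar isotopy, and the oriented Reidemeister moves

A diagram in a disk is encoded as an oriented plane graph: its vertices are the crossings, together
with one vertex for every boundary circle of the surface (each complementary disk is contracted to a
point of the sphere), and its edges are the pieces of strand in between. As usual, a connected plane
graph is given, up to orientation-preserving homeomorphism, by the cyclic counterclockwise order of
the ends of edges at each vertex, subject to Euler's formula. Crossings carry over/under
information and edges carry orientations. -/

namespace Reidemeister

/-- The boundary of a surface of genus zero: its end points of strands, their counterclockwise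
cyclic order around each complementary disk, and for each of them whether the strand runs from there
into the surface (`true`) or ends there (`false`). -/
structure Boundary where
  pt : Type
  [fin : Finite pt]
  rot : Equiv.Perm pt
  into : pt → Bool

/-- A disk with `n` end points on its boundary circle, numbered `0, …, n - 1` in the counterclockwise
direction along that circle. Seen from the complementary disk this order is reversed. -/
@[reducible] def Boundary.disk {n : ℕ} (w : Fin n → Bool) : Boundary where
  pt := Fin n
  rot := (finRotate n)⁻¹
  into := w

/-- A disk with a hole. The outer boundary is as in `Boundary.disk w`. The hole is a disk to be
filled by something with boundary `Boundary.disk v`, so its end points are also numbered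
counterclockwise, and a strand that runs into the hole ends there. -/
@[reducible] def Boundary.annulus {n k : ℕ} (w : Fin n → Bool) (v : Fin k → Bool) : Boundary where
  pt := Fin n ⊕ Fin k
  rot := Equiv.sumCongr (finRotate n)⁻¹ (finRotate k)
  into := Sum.elim w (fun i => !(v i))

/-- The four ends of edges at a crossing: where the overcrossing strand arrives and leaves and
where the undercrossing strand arrives and leaves. -/
inductive Port
  | overIn
  | overOut
  | underIn
  | underOut
  deriving DecidableEq

instance : Fintype Port :=
  ⟨{.overIn, .overOut, .underIn, .underOut}, by intro x; cases x <;> decide⟩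

/-- Does the strand leave the crossing here? -/
def Port.isOut : Port → Bool
  | .overIn => false
  | .overOut => true
  | .underIn => false
  | .underOut => true

/-- The counterclockwise next end at a positive crossing: if the overcrossing strand points east, then
the undercrossing strand points north. -/
def Port.turnPos : Port → Port
  | .overOut => .underOut
  | .underOut => .overIn
  | .overIn => .underIn
  | .underIn => .overOut

/-- The counterclockwise next end at a negative crossing: if the overcrossing strand points east, then
the undercrossing strand points south. -/
def Port.turnNeg : Port → Port
  | .overOut => .underIn
  | .underIn => .overIn
  | .overIn => .underOut
  | .underOut => .overOut

/-- The counterclockwise rotation at a crossing of the given sign (`true` for positive). -/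
def Port.turn : Bool → Equiv.Perm Port
  | true => ⟨turnPos, turnNeg ∘ turnNeg ∘ turnPos, by decide, by decide⟩
  | false => ⟨turnNeg, turnPos ∘ turnPos ∘ turnNeg, by decide, by decide⟩

/-- The darts (ends of edges) of a diagram with set of crossings `X`: one at every boundary point and
four at every crossing. -/
abbrev Dart (B : Boundary) (X : Type) : Type := B.pt ⊕ (X × Port)

/-- Does the strand run away from the vertex (crossing or boundary) to which the dart belongs? -/
def Dart.isOut {B : Boundary} {X : Type} : Dart B X → Bool
  | .inl b => B.into b
  | .inr (_, p) => p.isOut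

/-- The counterclockwise next dart at the same vertex. -/
def rotation (B : Boundary) {X : Type} (sign : X → Bool) : Equiv.Perm (Dart B X) :=
  Equiv.sumCongr B.rot (Equiv.prodShear (Equiv.refl X) (fun x => Port.turn (sign x)))

/-- The number of orbits of a permutation (of a finite set). -/
noncomputable def orbits {α : Type} (f : Equiv.Perm α) : ℕ :=
  Nat.card (Quotient (Equiv.Perm.SameCycle.setoid f))

/-- A connected oriented diagram, up to planar isotopy, on a surface of genus zero with boundary `B`
(connected means: together with the boundary circles). Every diagram in a disk all of whose components
are arcs is of this kind, and planar isotopies and Reidemeister moves inside the disk neither create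
nor remove closed components. -/
structure Diagram (B : Boundary) where
  /-- the crossings -/
  X : Type
  [finX : Finite X]
  /-- the signs of the crossings, `true` for positive -/
  sign : X → Bool
  /-- the other end of an edge -/
  link : Dart B X → Dart B X
  link_link : Function.Involutive link
  /-- every edge runs away from one of its two ends and towards the other one -/
  isOut_link : ∀ d, (link d).isOut = !d.isOut
  connected : ∀ d e, Relation.EqvGen (fun a b => b = link a ∨ b = rotation B sign a) d e
  /-- Euler's formula: vertices plus faces is edges plus two -/
  planar : orbits (rotation B sign) + orbits (rotation B sign * link_link.toPerm) =
    orbits link_link.toPerm + 2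

/-- Planar isotopy fixing the boundary: an isomorphism of oriented plane graphs that is the identity on
the boundary and preserves the crossing information. -/
def PlanarIsotopic {B : Boundary} (D D' : Diagram B) : Prop :=
  ∃ f : D.X ≃ D'.X, (∀ x, D'.sign (f x) = D.sign x) ∧
    ∀ d, D'.link (Sum.map id (Prod.map f id) d) = Sum.map id (Prod.map f id) (D.link d)

section Gluing

variable {n k : ℕ} {w : Fin n → Bool} {v : Fin k → Bool}

/-- Fill the hole of `C` with `T`. A dart of `C` or `T` is either a dart of the filled diagram, whose
crossings are those of `C` and `T`, or it lies on the boundary of the hole and meets there the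
dart of the other piece with the same number. -/
def across (C : Diagram (.annulus w v)) (T : Diagram (.disk v)) (D : Diagram (.disk w))
    (f : C.X ⊕ T.X ≃ D.X) :
    Dart (.annulus w v) C.X ⊕ Dart (.disk v) T.X →
      Dart (.disk w) D.X ⊕ (Dart (.annulus w v) C.X ⊕ Dart (.disk v) T.X)
  | .inl (.inl (.inl i)) => .inl (.inl i)
  | .inl (.inl (.inr j)) => .inr (.inr (.inl j))
  | .inl (.inr (x, p)) => .inl (.inr (f (.inl x), p))
  | .inr (.inl j) => .inr (.inl (.inl (.inr j)))
  | .inr (.inr (x, p)) => .inl (.inr (f (.inr x), p))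

/-- Having come along an edge of `C` or `T` to its end `j`, and crossing the boundary of the hole as
often as necessary, one arrives at the dart `d` of the filled diagram. -/
inductive Arrives (C : Diagram (.annulus w v)) (T : Diagram (.disk v)) (D : Diagram (.disk w))
    (f : C.X ⊕ T.X ≃ D.X) :
    Dart (.annulus w v) C.X ⊕ Dart (.disk v) T.X → Dart (.disk w) D.X → Prop
  | here {j d} : across C T D f j = .inl d → Arrives C T D f j d
  | pass {j j' d} : across C T D f j = .inr j' →
      Arrives C T D f (Sum.map C.link T.link j') d → Arrives C T D f j d

/-- `D` is the diagram that agrees with `C` outside a smaller disk (the hole of `C`) and with `T` inside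
that smaller disk. No strand of `C` and `T` gets lost as a closed curve without crossings. -/
def IsFilling (C : Diagram (.annulus w v)) (T : Diagram (.disk v)) (D : Diagram (.disk w)) : Prop :=
  ∃ f : C.X ⊕ T.X ≃ D.X,
    (∀ x, D.sign (f x) = Sum.elim C.sign T.sign x) ∧
    (∀ j d, across C T D f j = .inl d → Arrives C T D f (Sum.map C.link T.link j) (D.link d)) ∧
    (∀ j, ∃ d, Arrives C T D f j d)

end Gluing

/-! ### Pictures given by their strands -/

/-- The arrival at the crossing `x` on its upper (`true`) or lower strand. -/
def arrive {B : Boundary} {X : Type} : X × Bool → Dart B X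
  | (x, true) => .inr (x, .overIn)
  | (x, false) => .inr (x, .underIn)

/-- The departure from the crossing `x` on its upper (`true`) or lower strand. -/
def depart {B : Boundary} {X : Type} : X × Bool → Dart B X
  | (x, true) => .inr (x, .overOut)
  | (x, false) => .inr (x, .underOut)

/-- The edges of a strand that starts at the dart `a`, passes the listed crossings, on the upper (`true`)
or on the lower strand, and ends at the boundary point `z`. -/
def strandEdges {B : Boundary} {X : Type} (a : Dart B X) :
    List (X × Bool) → B.pt → List (Dart B X × Dart B X)
  | [], z => [(a, .inl z)]
  | c :: l, z => (a, arrive c) :: strandEdges (depart c) l z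

/-- All edges of a collection of strands. -/
def allEdges {B : Boundary} {X : Type} (L : List (B.pt × List (X × Bool) × B.pt)) :
    List (Dart B X × Dart B X) :=
  L.flatMap fun s => strandEdges (.inl s.1) s.2.1 s.2.2

/-- The other end of the edge at `d` in a list of edges. -/
def otherEnd {α : Type} [DecidableEq α] : List (α × α) → α → α
  | [], d => d
  | e :: E, d => if d = e.1 then e.2 else if d = e.2 then e.1 else otherEnd E d

/-- Is `b` among `a`, `f a`, …, the first `m` members of the orbit of `a`? -/
def hits {α : Type} [DecidableEq α] (f : α → α) (b : α) : ℕ → α → Bool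
  | 0, _ => false
  | m + 1, a => if a = b then true else hits f b m (f a)

theorem hits_iff {α : Type} [DecidableEq α] (f : α → α) (b : α) (m : ℕ) (a : α) :
    hits f b m a = true ↔ ∃ k < m, f^[k] a = b := by
  induction m generalizing a with
  | zero => simp [hits]
  | succ m ih =>
    rw [hits]
    split_ifs with h
    · simp only [true_iff]; exact ⟨0, m.succ_pos, h⟩
    · rw [ih]
      constructor
      · rintro ⟨k, hk, e⟩; exact ⟨k + 1, by omega, e⟩
      · rintro ⟨_ | k, hk, e⟩
        · exact absurd e h
        · exact ⟨k, by omega, e⟩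

theorem hits_card_iff {α : Type} [Fintype α] [DecidableEq α] (f : Equiv.Perm α) (a b : α) :
    hits f b (Fintype.card α) a = true ↔ f.SameCycle a b := by
  rw [hits_iff]
  constructor
  · rintro ⟨k, -, e⟩
    exact ⟨k, by rw [← e, zpow_natCast, ← Equiv.Perm.iterate_eq_pow]⟩
  · intro h
    by_cases hx : a ∈ f.support
    · obtain ⟨k, hk, e⟩ := h.exists_pow_eq_of_mem_support hx
      refine ⟨k, hk.trans_le (Finset.card_le_univ _), ?_⟩
      rw [← e, ← Equiv.Perm.iterate_eq_pow]
    · rw [Equiv.Perm.notMem_support] at hx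
      obtain ⟨k, e⟩ := h
      refine ⟨0, Fintype.card_pos_iff.2 ⟨a⟩, ?_⟩
      rw [← e, Equiv.Perm.zpow_apply_eq_self_of_apply_eq_self hx]; rfl

/-- The number of orbits that meet the list `l`, computed. -/
def countOrbits {α : Type} [DecidableEq α] (f : α → α) (N : ℕ) : List α → ℕ
  | [] => 0
  | a :: l => if l.any (fun b => hits f b N a) then countOrbits f N l else countOrbits f N l + 1

theorem ncard_orbits_list {α : Type} [Fintype α] [DecidableEq α] (f : Equiv.Perm α) (l : List α) :
    {q : Quotient (Equiv.Perm.SameCycle.setoid f) | ∃ a ∈ l, ⟦a⟧ = q}.ncard =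
      countOrbits f (Fintype.card α) l := by
  induction l with
  | nil => simp [countOrbits]
  | cons a l ih =>
    have hins : {q : Quotient (Equiv.Perm.SameCycle.setoid f) | ∃ b ∈ a :: l, ⟦b⟧ = q} =
        insert ⟦a⟧ {q | ∃ b ∈ l, ⟦b⟧ = q} := by
      ext q; simp [eq_comm]
    have hmem : (l.any fun b => hits f b (Fintype.card α) a) = true ↔
        (⟦a⟧ : Quotient (Equiv.Perm.SameCycle.setoid f)) ∈ {q | ∃ b ∈ l, ⟦b⟧ = q} := by
      simp only [List.any_eq_true, hits_card_iff, Set.mem_ofPred_eq]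
      refine exists_congr fun b => and_congr_right fun _ => ?_
      rw [Quotient.eq]; exact Equiv.Perm.sameCycle_comm
    rw [hins, countOrbits]
    split_ifs with h
    · rw [Set.insert_eq_of_mem (hmem.1 h), ih]
    · rw [Set.ncard_insert_of_notMem (fun h' => h (hmem.2 h')) (Set.toFinite _), ih]

theorem orbits_eq_countOrbits {α : Type} [Fintype α] [DecidableEq α] (f : Equiv.Perm α) (l : List α)
    (hl : ∀ a, a ∈ l) : orbits f = countOrbits f (Fintype.card α) l := by
  rw [← ncard_orbits_list, orbits, ← Set.ncard_univ]
  congr 1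
  ext q
  induction q using Quotient.inductionOn with
  | h a => simpa using ⟨a, hl a, rfl⟩

/-- The elements that are joined to elements of `s` by at most `m` steps. -/
def spread {α : Type} [DecidableEq α] (f g : α → α) : ℕ → Finset α → Finset α
  | 0, s => s
  | m + 1, s => spread f g m (s ∪ s.image f ∪ s.image g)

theorem eqvGen_of_mem_spread {α : Type} [DecidableEq α] (f g : α → α) (a : α) (m : ℕ)
    (s : Finset α) (hs : ∀ b ∈ s, Relation.EqvGen (fun a b => b = f a ∨ b = g a) a b) :
    ∀ b ∈ spread f g m s, Relation.EqvGen (fun a b => b = f a ∨ b = g a) a b := by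
  induction m generalizing s with
  | zero => exact hs
  | succ m ih =>
    refine ih _ fun b hb => ?_
    simp only [Finset.mem_union, Finset.mem_image] at hb
    rcases hb with (hb | ⟨c, hc, rfl⟩) | ⟨c, hc, rfl⟩
    · exact hs b hb
    · exact .trans _ _ _ (hs c hc) (.rel _ _ (.inl rfl))
    · exact .trans _ _ _ (hs c hc) (.rel _ _ (.inr rfl))

/-- All darts of a diagram with `n` boundary points and `c` crossings. -/
def dartList (n c : ℕ) (w : Fin n → Bool) : List (Dart (.disk w) (Fin c)) :=
  (List.finRange n).map .inl ++ (List.finRange c).flatMap fun x =>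
    [.inr (x, .overIn), .inr (x, .overOut), .inr (x, .underIn), .inr (x, .underOut)]

theorem mem_dartList (n c : ℕ) (w : Fin n → Bool) (d : Dart (.disk w) (Fin c)) :
    d ∈ dartList n c w := by
  rcases d with i | ⟨x, p⟩
  · simp [dartList]
  · cases p <;> simp [dartList]

/-- The other end of an edge in the picture with strands `L`. -/
abbrev strandLink {n c : ℕ} (w : Fin n → Bool) (L : List (Fin n × List (Fin c × Bool) × Fin n)) :
    Dart (.disk w) (Fin c) → Dart (.disk w) (Fin c) :=
  otherEnd (allEdges (B := .disk w) L)

/-- The strands in `L` form a diagram, in a form that can be checked by evaluation. -/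
abbrev IsPicture {n c : ℕ} [NeZero n] (w : Fin n → Bool) (sign : Fin c → Bool)
    (L : List (Fin n × List (Fin c × Bool) × Fin n)) : Prop :=
  (∀ d, strandLink w L (strandLink w L d) = d) ∧
  (∀ d, (strandLink w L d).isOut = !d.isOut) ∧
  (∀ d, d ∈ spread (strandLink w L) (rotation (.disk w) sign) 8 {.inl 0}) ∧
  countOrbits (rotation (.disk w) sign) (Fintype.card (Dart (.disk w) (Fin c))) (dartList n c w) +
      countOrbits (fun d => rotation (.disk w) sign (strandLink w L d))
        (Fintype.card (Dart (.disk w) (Fin c))) (dartList n c w) =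
    countOrbits (strandLink w L) (Fintype.card (Dart (.disk w) (Fin c))) (dartList n c w) + 2

/-- The diagram in a disk whose strands are listed in `L`, each with its first boundary point, the
crossings it passes (on the upper strand: `true`, on the lower one: `false`), and its last boundary
point. -/
def Diagram.ofStrands {n c : ℕ} [NeZero n] (w : Fin n → Bool) (sign : Fin c → Bool)
    (L : List (Fin n × List (Fin c × Bool) × Fin n)) (h : IsPicture w sign L) :
    Diagram (.disk w) where
  X := Fin c
  sign := sign
  link := strandLink w L
  link_link := h.1
  isOut_link := h.2.1
  connected d e := by
    have key : ∀ x, Relation.EqvGen (fun a b => b = strandLink w L a ∨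
        b = rotation (.disk w) sign a) (.inl 0) x := fun x =>
      eqvGen_of_mem_spread _ _ _ _ _
        (fun b hb => by rw [Finset.mem_singleton.1 hb]; exact .refl _) x (h.2.2.1 x)
    exact .trans _ _ _ (.symm _ _ (key d)) (key e)
  planar := by
    rw [orbits_eq_countOrbits _ _ (mem_dartList n c w), orbits_eq_countOrbits _ _ (mem_dartList n c w),
      orbits_eq_countOrbits _ _ (mem_dartList n c w)]
    exact h.2.2.2

/-! ### The sixteen oriented Reidemeister moves -/

/-- A local move: it replaces one diagram in a disk by another one with the same boundary. -/
structure LocalMove where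
  {n : ℕ}
  w : Fin n → Bool
  before : Diagram (.disk w)
  after : Diagram (.disk w)

/-- Type 1: a strand from point `0` to point `1` gets a kink with a crossing of the given sign, where it
passes first over and then under itself (`overFirst`) or conversely. The loop is
counterclockwise if the end of the loop is the counterclockwise next one, at the crossing, after the
beginning of the loop, that is, if the sign is positive and the strand first passes under itself, or
the sign is negative and the strand first passes over itself; otherwise it is clockwise. -/
def omega1 (sign overFirst : Bool) : LocalMove where
  w := ![true, false]
  before := .ofStrands ![true, false] ![] [(0, [], 1)] (by decide +kernel)
  after := .ofStrands ![true, false] ![sign] [(0, [(0, overFirst), (0, !overFirst)], 1)]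
    (by revert sign overFirst; decide +kernel)

/-- Type 2 with parallel strands. The points `0`, `1`, `2`, `3` are south-west, south-east, north-east and
north-west; both strands run north, and the western one is pushed over the eastern one
(`westOver`, the first crossing is positive) or under it (the first crossing is negative). -/
def omega2parallel (westOver : Bool) : LocalMove where
  w := ![true, true, false, false]
  before := .ofStrands ![true, true, false, false] ![] [(0, [], 3), (1, [], 2)] (by decide +kernel)
  after := .ofStrands ![true, true, false, false] ![westOver, !westOver]
    [(0, [(0, westOver), (1, westOver)], 3), (1, [(0, !westOver), (1, !westOver)], 2)]
    (by revert westOver; decide +kernel)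

/-- Type 2 with antiparallel strands, the western one running north, and the eastern one running south;
the western strand is pushed over the eastern one (pushing it under the eastern one gives the same
picture rotated by a half turn). The bigon, which lies between the northward strand in
the east and the southward strand in the west, is counterclockwise. Crossing `0` is the southern one. -/
def omega2counterclockwise : LocalMove where
  w := ![true, false, true, false]
  before := .ofStrands ![true, false, true, false] ![] [(0, [], 3), (2, [], 1)] (by decide +kernel)
  after := .ofStrands ![true, false, true, false] ![false, true]
    [(0, [(0, true), (1, true)], 3), (2, [(1, false), (0, false)], 1)] (by decide +kernel)

/-- The same with the western strand running south and the eastern strand running north. The bigon is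
clockwise. -/
def omega2clockwise : LocalMove where
  w := ![false, true, false, true]
  before := .ofStrands ![false, true, false, true] ![] [(3, [], 0), (1, [], 2)] (by decide +kernel)
  after := .ofStrands ![false, true, false, true] ![false, true]
    [(3, [(1, true), (0, true)], 0), (1, [(0, false), (1, false)], 2)] (by decide +kernel)

/-- Type 3. The points `0`, …, `5` are at the angles `0°`, `60°`, …, `300°`. The arguments are the signs of
the crossings of the top and middle strands, of the top and bottom strands, and of the middle and
bottom strands. The top strand runs from `3` to `0`. The other two strands are on the lines `4 — 1` and
`5 — 2`, and they run north if their crossing with the top strand is positive, and south otherwise.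
The middle strand is on the line `4 — 1` if the product of the three signs is
positive, and otherwise on the line `5 — 2`. Here is the list of in-going end points. -/
def omega3word (tm tb mb : Bool) : Fin 6 → Bool :=
  if (tm == tb) == mb then ![false, !tm, !tb, true, tm, tb] else ![false, !tb, !tm, true, tb, tm]

/-- The strands in the disk of a type 3 move. The crossing of the top and middle strands is `0`, that of
the top and bottom strands is `1`, and that of the middle and bottom strands is `2`. The top strand
runs south of crossing `2` (`north = false`) or north of it (`north = true`). -/
def omega3strands (tm tb mb north : Bool) : List (Fin 6 × List (Fin 3 × Bool) × Fin 6) :=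
  let middleLine : Fin 6 × Fin 6 := if (tm == tb) == mb then (4, 1) else (5, 2)
  let bottomLine : Fin 6 × Fin 6 := if (tm == tb) == mb then (5, 2) else (4, 1)
  [(3, if ((tm == tb) == mb) == north then [(1, true), (0, true)] else [(0, true), (1, true)], 0),
    (if tm then middleLine.1 else middleLine.2,
      if tm == north then [(2, true), (0, false)] else [(0, false), (2, true)],
      if tm then middleLine.2 else middleLine.1),
    (if tb then bottomLine.1 else bottomLine.2,
      if tb == north then [(2, false), (1, false)] else [(1, false), (2, false)],
      if tb then bottomLine.2 else bottomLine.1)]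

theorem omega3_isPicture : ∀ tm tb mb north : Bool,
    IsPicture (omega3word tm tb mb) ![tm, tb, mb] (omega3strands tm tb mb north) := by
  decide +kernel

/-- The type 3 move with the given signs of crossings, as described at `omega3word`. -/
def omega3 (tm tb mb : Bool) : LocalMove where
  w := omega3word tm tb mb
  before := .ofStrands _ _ _ (omega3_isPicture tm tb mb false)
  after := .ofStrands _ _ _ (omega3_isPicture tm tb mb true)

/-- The names of the sixteen oriented Reidemeister moves. -/
inductive Move
  | omega1a
  | omega1b
  | omega1c
  | omega1d
  | omega2a
  | omega2b
  | omega2c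
  | omega2d
  | omega3a
  | omega3b
  | omega3c
  | omega3d
  | omega3e
  | omega3f
  | omega3g
  | omega3h

/-- The sixteen oriented Reidemeister moves.
Type 1: `a` positive crossing, clockwise loop; `b` positive, counterclockwise; `c` negative,
clockwise; `d` negative, counterclockwise.
Type 2: `a` parallel strands, first a positive and then a negative crossing; `b` parallel strands,
first negative; `c` counterclockwise bigon; `d` clockwise bigon.
Type 3: `a` two positive crossings, coherently oriented triangle; `b` three positive crossings; `c` two
negative crossings, a strand slides over the positive crossing; `d` two positive crossings, a strand
slides over the negative crossing; `e` two positive crossings, a strand slides under the negative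
crossing; `f` two negative crossings, a strand slides under the positive crossing; `g` three negative
crossings; `h` two negative crossings, coherently oriented triangle. -/
def Move.toLocalMove : Move → LocalMove
  | .omega1a => omega1 true true
  | .omega1b => omega1 true false
  | .omega1c => omega1 false false
  | .omega1d => omega1 false true
  | .omega2a => omega2parallel true
  | .omega2b => omega2parallel false
  | .omega2c => omega2counterclockwise
  | .omega2d => omega2clockwise
  | .omega3a => omega3 true false true
  | .omega3b => omega3 true true true
  | .omega3c => omega3 false false true
  | .omega3d => omega3 true true false
  | .omega3e => omega3 false true true
  | .omega3f => omega3 true false false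
  | .omega3g => omega3 false false false
  | .omega3h => omega3 false true false

/-! ### Generating sets -/

/-- `D` can be turned into `D'`, inside the disk and with fixed boundary, by a finite sequence of planar
isotopies and moves from `S` (in both directions), each applied in the disk itself or in a
smaller disk inside it. -/
inductive Realizable (S : Set Move) :
    ∀ {n : ℕ} {w : Fin n → Bool}, Diagram (.disk w) → Diagram (.disk w) → Prop
  | isotopy {n : ℕ} {w : Fin n → Bool} {D D' : Diagram (.disk w)} :
      PlanarIsotopic D D' → Realizable S D D'
  | move {m : Move} : m ∈ S → Realizable S m.toLocalMove.before m.toLocalMove.after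
  | inside {n k : ℕ} {w : Fin n → Bool} {v : Fin k → Bool} {C : Diagram (.annulus w v)}
      {T T' : Diagram (.disk v)} {D D' : Diagram (.disk w)} :
      IsFilling C T D → IsFilling C T' D' → Realizable S T T' → Realizable S D D'
  | symm {n : ℕ} {w : Fin n → Bool} {D D' : Diagram (.disk w)} :
      Realizable S D D' → Realizable S D' D
  | trans {n : ℕ} {w : Fin n → Bool} {D D' D'' : Diagram (.disk w)} :
      Realizable S D D' → Realizable S D' D'' → Realizable S D D''

/-- A set of oriented Reidemeister moves is generating if every oriented Reidemeister move can be realized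
inside its disk by planar isotopies and moves from the set. -/
def IsGeneratingSet (S : Set Move) : Prop :=
  ∀ m : Move, Realizable S m.toLocalMove.before m.toLocalMove.after

open Move in
/-- The six sets in the collection `𝒜`. -/
def collectionA : Set (Set Move) :=
  {{omega1a, omega1c, omega2a, omega3a}, {omega1a, omega1c, omega2b, omega3a},
    {omega1b, omega1d, omega2a, omega3a}, {omega1b, omega1d, omega2b, omega3a},
    {omega1a, omega1b, omega2a, omega3a}, {omega1a, omega1b, omega2b, omega3a}}

open Move in
/-- The six sets in the collection `ℋ`. -/
def collectionH : Set (Set Move) :=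
  {{omega1a, omega1c, omega2a, omega3h}, {omega1a, omega1c, omega2b, omega3h},
    {omega1b, omega1d, omega2a, omega3h}, {omega1b, omega1d, omega2b, omega3h},
    {omega1c, omega1d, omega2a, omega3h}, {omega1c, omega1d, omega2b, omega3h}}

end Reidemeister

/-! The proof is a collection of explicit sequences of pictures.

Kinks turn antiparallel strands into parallel ones, since the loop of a kink runs backwards
somewhere. Give one of two antiparallel strands a kink, let the other strand cross its loop by a
parallel type 2 move, carry that strand across the crossing of the kink by a coherent type 3 move,
and remove the kink, which is now free: this realizes Ω2c or Ω2d. Conversely, two nested kinks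
reverse direction twice, which gives Ω2a and Ω2b from Ω2c; at the end the two kinks cancel each
other. An antiparallel type 2 move of a strand with itself makes two nested kinks of opposite signs;
removing the inner one leaves a new kind of kink. One further trade, through a triangle formed by a
kink and an end of its own strand, exchanges clockwise and counterclockwise kinks of the same sign.

For type 3, the sign triples are the vertices of a cube. Two adjacent moves are obtained from each
other by creating a bigon of the two strands whose sign differs, applying the known move to the
triangle at one of the new crossings, and removing a bigon on the other side. Type 2 moves in all
directions thus connect all eight.

Switching all crossings exchanges Ω1a with Ω1c, Ω1b with Ω1d, Ω2a with Ω2b and Ω3a with Ω3h,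
preserves Ω2c and Ω2d, and takes 𝒜 to ℋ. The derivations with Ω3h follow this symmetry, but are
given by pictures of their own.

Each sequence is verified by evaluation in the kernel. For this a `Picture` keeps only the finite
data of a diagram, and `IsDiagram`, `Fills` and `Replaces` are decidable conditions that imply the
geometric ones (`Picture.diagram`, `Fills.isFilling`, `Replaces.realizable`). `Derivable.of_steps`
turns a verified list of steps into a realization; its steps may use every move already derived,
because a realization can be carried out inside a smaller disk. -/

namespace Reidemeister

/-! ### Equality of darts by comparison of numbers -/

/-- An injective numbering, used to compare elements quickly. -/
class Coded (α : Type) where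
  code : α → ℕ
  code_injective : Function.Injective code

namespace Coded

/-- Do `a` and `b` have the same number? -/
def same {α : Type} [Coded α] (a b : α) : Bool := Nat.beq (code a) (code b)

theorem same_iff {α : Type} [Coded α] {a b : α} : same a b = true ↔ a = b := by
  rw [same, Nat.beq_eq, code_injective.eq_iff]

/-- Equality decided by comparison of numbers. -/
@[reducible] def decEq (α : Type) [Coded α] : DecidableEq α := fun _ _ => decidable_of_iff _ same_iff

instance {n : ℕ} : Coded (Fin n) := ⟨Fin.val, Fin.val_injective⟩

instance : Coded Port where
  code
    | .overIn => 0
    | .overOut => 1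
    | .underIn => 2
    | .underOut => 3
  code_injective := by intro a b; cases a <;> cases b <;> simp

instance {α β : Type} [Coded α] [Coded β] : Coded (α ⊕ β) where
  code
    | .inl a => 2 * code a
    | .inr b => 2 * code b + 1
  code_injective := by
    rintro (a | a) (b | b) h <;> simp only at h
    · rw [code_injective (Nat.eq_of_mul_eq_mul_left two_pos h)]
    · omega
    · omega
    · rw [code_injective (a₁ := a) (a₂ := b) (by omega)]

instance {α : Type} [Coded α] : Coded (α × Port) where
  code a := 4 * code a.1 + code a.2
  code_injective := by
    have hlt : ∀ p : Port, code p < 4 := by intro p; cases p <;> simp [code]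
    rintro ⟨x, p⟩ ⟨y, q⟩ h
    have hp := hlt p
    have hq := hlt q
    simp only at h
    rw [code_injective (a₁ := x) (a₂ := y) (by omega), code_injective (a₁ := p) (a₂ := q) (by omega)]

end Coded

open Coded

/-! ### Orbits and connectedness by evaluation -/

/-- The list `b`, `f b`, …, up to the first member that `f` sends to `a`, but with at most `m`
members. -/
def cycleUntil {α : Type} [Coded α] (f : α → α) (a : α) : ℕ → α → List α
  | 0, _ => []
  | m + 1, b => b :: bif same (f b) a then [] else cycleUntil f a m (f b)

theorem exists_iterate_of_mem_cycleUntil {α : Type} [Coded α] {f : α → α} {a : α} {m : ℕ} {b c : α}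
    (h : c ∈ cycleUntil f a m b) : ∃ k, f^[k] b = c := by
  induction m generalizing b with
  | zero => simp [cycleUntil] at h
  | succ m ih =>
    rw [cycleUntil, List.mem_cons] at h
    rcases h with rfl | h
    · exact ⟨0, rfl⟩
    · cases hs : same (f b) a <;> rw [hs] at h
      · obtain ⟨k, e⟩ := ih h
        exact ⟨k + 1, e⟩
      · simp at h

/-- The list breaks off early only when the next member would be `a`, so a missing iterate lies
beyond a visit to `a`. -/
theorem iterate_mem_cycleUntil {α : Type} [Coded α] (f : α → α) (a : α) {m k : ℕ} (hk : k < m)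
    (b : α) : f^[k] b ∈ cycleUntil f a m b ∨ ∃ i < k, f^[i + 1] b = a := by
  induction m generalizing b k with
  | zero => exact absurd hk k.not_lt_zero
  | succ m ih =>
    rw [cycleUntil, List.mem_cons]
    rcases k with _ | k
    · exact .inl (.inl rfl)
    · cases hs : same (f b) a
      · rcases ih (Nat.lt_of_succ_lt_succ hk) (f b) with h | ⟨i, hi, e⟩
        · exact .inl (.inr h)
        · exact .inr ⟨i + 1, Nat.succ_lt_succ hi, e⟩
      · exact .inr ⟨0, k.succ_pos, same_iff.1 hs⟩

theorem mem_cycleUntil_iff {α : Type} [Fintype α] [Coded α] (f : Equiv.Perm α) {N : ℕ}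
    (hN : Fintype.card α ≤ N) (a b : α) : b ∈ cycleUntil f a N a ↔ f.SameCycle a b := by
  constructor
  · intro h
    obtain ⟨k, e⟩ := exists_iterate_of_mem_cycleUntil h
    exact ⟨k, by rw [← e, zpow_natCast, ← Equiv.Perm.iterate_eq_pow]⟩
  · intro h
    let := Coded.decEq α
    have hex := (hits_iff f b _ a).1 ((hits_card_iff f a b).2 h)
    obtain ⟨hlt, e⟩ := Nat.find_spec hex
    rcases iterate_mem_cycleUntil f a (hlt.trans_le hN) a with h | ⟨i, hi, ei⟩
    · rwa [e] at h
    -- For the least exponent leading from `a` to `b`, a return to `a` after `i + 1` steps is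
    -- impossible: leaving out these steps would give a smaller exponent.
    · refine absurd ⟨by omega, ?_⟩ (Nat.find_min hex (m := Nat.find hex - (i + 1)) (by omega))
      rw [← Nat.sub_add_cancel (Nat.succ_le_of_lt hi), Function.iterate_add_apply] at e
      exact (congrArg _ ei).symm.trans e

/-- The number of orbits of `f` that meet the list `l` (of length at most `m`), provided that no orbit
has more than `N` members. -/
def countCycles {α : Type} [Coded α] (f : α → α) (N : ℕ) : ℕ → List α → ℕ
  | 0, _ => 0
  | _ + 1, [] => 0
  | m + 1, a :: l =>
    countCycles f N m (l.filter fun b => !(cycleUntil f a N a).any fun c => same c b) + 1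

/-- Filtering out the orbit of the head removes exactly one class from those that meet the list. The
number `m` only bounds the recursion, and the length of the list suffices because filtering does not
lengthen the tail. -/
theorem ncard_orbits_eq_countCycles {α : Type} [Fintype α] [Coded α] (f : Equiv.Perm α)
    {N : ℕ} (hN : Fintype.card α ≤ N) (m : ℕ) (l : List α) (hm : l.length ≤ m) :
    {q : Quotient (Equiv.Perm.SameCycle.setoid f) | ∃ a ∈ l, ⟦a⟧ = q}.ncard =
      countCycles f N m l := by
  induction m generalizing l with
  | zero => obtain rfl := List.length_eq_zero_iff.1 (Nat.le_zero.1 hm); simp [countCycles]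
  | succ m ih =>
    cases l with
    | nil => simp [countCycles]
    | cons a l =>
      have hmem : ∀ b, b ∈ l.filter (fun b => !(cycleUntil f a N a).any fun c => same c b) ↔
          b ∈ l ∧ ¬ f.SameCycle a b := by
        intro b
        simp only [List.mem_filter, Bool.not_eq_true', List.any_eq_false, same_iff,
          ← mem_cycleUntil_iff f hN]
        exact and_congr_right fun _ => ⟨fun h hb => h b hb rfl, fun h c hc e => h (e ▸ hc)⟩
      rw [countCycles, ← ih _ ((List.length_filter_le _ l).trans (Nat.le_of_succ_le_succ hm)),
        ← Set.ncard_insert_of_notMem (a := ⟦a⟧) _ (Set.toFinite _)]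
      · congr 1
        ext q
        simp only [List.mem_cons, exists_eq_or_imp, Set.mem_ofPred_eq, Set.mem_insert_iff, hmem]
        constructor
        · rintro (rfl | ⟨b, hb, rfl⟩)
          · exact .inl rfl
          · by_cases h : f.SameCycle a b
            · exact .inl (Quotient.sound h.symm)
            · exact .inr ⟨b, ⟨hb, h⟩, rfl⟩
        · rintro (rfl | ⟨b, hb, rfl⟩)
          · exact .inl rfl
          · exact .inr ⟨b, hb.1, rfl⟩
      · simp only [Set.mem_ofPred_eq, hmem]
        rintro ⟨b, hb, e⟩
        exact hb.2 (Quotient.exact e.symm)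

theorem orbits_eq_countCycles {α : Type} [Fintype α] [Coded α] (f : Equiv.Perm α) (l : List α)
    (hl : ∀ a, a ∈ l) : orbits f = countCycles f l.length l.length l := by
  let := Coded.decEq α
  -- A list that exhausts the type is at least as long as any orbit; repetitions do no harm.
  have hN : Fintype.card α ≤ l.length := by
    rw [← Finset.card_univ]
    exact (Finset.card_le_card fun a _ => List.mem_toFinset.2 (hl a)).trans (List.toFinset_card_le l)
  rw [← ncard_orbits_eq_countCycles f hN _ _ le_rfl, orbits, ← Set.ncard_univ]
  congr 1
  ext q
  induction q using Quotient.inductionOn with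
  | h a => simpa using ⟨a, hl a, rfl⟩

/-- The elements found from those in `todo` and `seen` in a search along `f` and `g`. -/
def explore {α : Type} [Coded α] (f g : α → α) : ℕ → List α → List α → List α
  | 0, _, seen => seen
  | _ + 1, [], seen => seen
  | m + 1, a :: todo, seen =>
    bif seen.any fun b => same b a then explore f g m todo seen
    else explore f g m (f a :: g a :: todo) (a :: seen)

/-- Only soundness of the search is needed. That it reaches every dart is checked by evaluation for
each picture. -/
theorem eqvGen_of_mem_explore {α : Type} [Coded α] (f g : α → α) (a : α) (m : ℕ)
    (todo seen : List α)
    (htodo : ∀ b ∈ todo, Relation.EqvGen (fun a b => b = f a ∨ b = g a) a b)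
    (hseen : ∀ b ∈ seen, Relation.EqvGen (fun a b => b = f a ∨ b = g a) a b) :
    ∀ b ∈ explore f g m todo seen, Relation.EqvGen (fun a b => b = f a ∨ b = g a) a b := by
  induction m generalizing todo seen with
  | zero => exact hseen
  | succ m ih =>
    cases todo with
    | nil => exact hseen
    | cons c todo =>
      rw [List.forall_mem_cons] at htodo
      rw [explore]
      cases seen.any fun b => same b c
      · refine ih _ _ ?_ ?_
        · simp only [List.forall_mem_cons]
          exact ⟨.trans _ _ _ htodo.1 (.rel _ _ (.inl rfl)),
            .trans _ _ _ htodo.1 (.rel _ _ (.inr rfl)), htodo.2⟩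
        · exact List.forall_mem_cons.2 ⟨htodo.1, hseen⟩
      · exact ih _ _ htodo.2 hseen

/-! ### Pictures whose properties can be checked by evaluation -/

/-- Crossings and edges in a surface with boundary `B`, not necessarily those of a diagram. -/
structure Picture (B : Boundary) where
  c : ℕ
  sign : Fin c → Bool
  link : Dart B (Fin c) → Dart B (Fin c)

namespace Picture

variable {B : Boundary}

/-- The picture with the given strands, see `Diagram.ofStrands`. -/
@[reducible] def ofStrands [Coded B.pt] (c : ℕ) (sign : Fin c → Bool)
    (L : List (B.pt × List (Fin c × Bool) × B.pt)) : Picture B :=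
  ⟨c, sign, @otherEnd _ (Coded.decEq _) (allEdges L)⟩

/-- All darts of a picture, given a list of the boundary points. -/
def darts (P : Picture B) (pts : List B.pt) : List (Dart B (Fin P.c)) :=
  pts.map .inl ++ (List.finRange P.c).flatMap fun x =>
    [.inr (x, .overIn), .inr (x, .overOut), .inr (x, .underIn), .inr (x, .underOut)]

theorem mem_darts (P : Picture B) {pts : List B.pt} (hpts : ∀ b, b ∈ pts)
    (d : Dart B (Fin P.c)) : d ∈ P.darts pts := by
  rcases d with i | ⟨x, p⟩
  · simpa [darts] using hpts i
  · cases p <;> simp [darts]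

/-- The number of vertices, edges or faces: the number of orbits of a permutation of the darts. -/
def count [Coded B.pt] (P : Picture B) (pts : List B.pt)
    (f : Dart B (Fin P.c) → Dart B (Fin P.c)) : ℕ :=
  countCycles f (P.darts pts).length (P.darts pts).length (P.darts pts)

/-- The picture is a diagram. The list `pts` enumerates the boundary points. -/
def IsDiagram [Fintype B.pt] [Coded B.pt] (P : Picture B) (pts : List B.pt) : Prop :=
  (∀ d, same (P.link (P.link d)) d = true) ∧
  (∀ d, (P.link d).isOut = !d.isOut) ∧
  (∀ b, (pts.any fun c => same c b) = true) ∧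
  (∀ d, ((explore P.link (rotation B P.sign) (3 * (P.darts pts).length) ((P.darts pts).take 1) []).any
    fun e => same e d) = true) ∧
  P.count pts (rotation B P.sign) + P.count pts (fun d => rotation B P.sign (P.link d)) =
    P.count pts P.link + 2

instance [Fintype B.pt] [Coded B.pt] (P : Picture B) (pts : List B.pt) :
    Decidable (P.IsDiagram pts) := by
  unfold IsDiagram; infer_instance

theorem IsDiagram.mem_darts [Fintype B.pt] [Coded B.pt] {P : Picture B} {pts : List B.pt}
    (h : P.IsDiagram pts) (d : Dart B (Fin P.c)) : d ∈ P.darts pts :=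
  P.mem_darts (fun b => by simpa [same_iff] using h.2.2.1 b) d

/-- The diagram shown by a picture. -/
def diagram [Fintype B.pt] [Coded B.pt] (P : Picture B) {pts : List B.pt} (h : P.IsDiagram pts) :
    Diagram B where
  X := Fin P.c
  sign := P.sign
  link := P.link
  link_link d := same_iff.1 (h.1 d)
  isOut_link := h.2.1
  connected d e := by
    -- The base dart is the first in the list. Writing it as `take 1` avoids a nonemptiness
    -- assumption; for an empty list the condition is vacuous.
    obtain ⟨o, ho⟩ : ∃ o, ∀ b ∈ (P.darts pts).take 1, b = o := by
      rcases P.darts pts with _ | ⟨a, l⟩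
      · exact ⟨d, by simp⟩
      · exact ⟨a, by simp⟩
    have key : ∀ x, Relation.EqvGen (fun a b => b = P.link a ∨ b = rotation B P.sign a) o x :=
      fun x => eqvGen_of_mem_explore _ _ _ _ _ [] (fun b hb => ho b hb ▸ .refl _) (by simp) x
        (by simpa [same_iff] using h.2.2.2.1 x)
    exact .trans _ _ _ (.symm _ _ (key d)) (key e)
  planar := by
    rw [orbits_eq_countCycles _ _ h.mem_darts, orbits_eq_countCycles _ _ h.mem_darts,
      orbits_eq_countCycles _ _ h.mem_darts]
    exact h.2.2.2.2

end Picture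

namespace Picture

variable {n k : ℕ} {w : Fin n → Bool} {v : Fin k → Bool}

/-! ### Filling a hole and cutting a hole, by evaluation -/

/-- The name, in a picture with `c` crossings, of a crossing outside or inside a smaller disk. The
crossings inside are named in `l`, and those outside have the remaining names, in order. -/
def naming (c : ℕ) (l : List ℕ) {a t : ℕ} : Fin a ⊕ Fin t → ℕ
  -- The default `c` is not the name of a crossing, so a list of names of the wrong length makes
  -- `Fills` fail.
  | .inl x => ((List.range c).filter fun y => !l.any (Nat.beq y)).getD x c
  | .inr y => l.getD y c

/-- The dart of the filled picture at the dart `j`, or the dart met by `j` on the boundary of the hole,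
see `across`. -/
def meet {a t c : ℕ} (f : Fin a ⊕ Fin t → Fin c) :
    Dart (.annulus w v) (Fin a) ⊕ Dart (.disk v) (Fin t) →
      Dart (.disk w) (Fin c) ⊕ (Dart (.annulus w v) (Fin a) ⊕ Dart (.disk v) (Fin t))
  | .inl (.inl (.inl i)) => .inl (.inl i)
  | .inl (.inl (.inr j)) => .inr (.inr (.inl j))
  | .inl (.inr (x, p)) => .inl (.inr (f (.inl x), p))
  | .inr (.inl j) => .inr (.inl (.inl (.inr j)))
  | .inr (.inr (x, p)) => .inl (.inr (f (.inr x), p))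

/-- The dart at which one arrives from `j`, if the boundary of the hole is crossed fewer times than the
given number, see `Arrives`. -/
def arrival (C : Picture (.annulus w v)) (T : Picture (.disk v)) {c : ℕ}
    (f : Fin C.c ⊕ Fin T.c → Fin c) :
    ℕ → Dart (.annulus w v) (Fin C.c) ⊕ Dart (.disk v) (Fin T.c) → Option (Dart (.disk w) (Fin c))
  | 0, _ => none
  | m + 1, j =>
    match meet f j with
    | .inl d => some d
    | .inr j' => arrival C T f m (Sum.map C.link T.link j')

/-- The hole of `C` filled with `T` is `D`, where the crossings of `T` are named in `l`. -/
def Fills (C : Picture (.annulus w v)) (T : Picture (.disk v)) (D : Picture (.disk w))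
    (l : List ℕ) : Prop :=
  ∃ h : ∀ x : Fin C.c ⊕ Fin T.c, naming D.c l x < D.c,
    Function.Bijective (fun x => (⟨naming D.c l x, h x⟩ : Fin D.c)) ∧
    (∀ x, D.sign ⟨naming D.c l x, h x⟩ = Sum.elim C.sign T.sign x) ∧
    -- The hole of a move has at most six end points, and a strand that is not closed crosses each
    -- of them at most once, so a bound of 8 suffices. Nothing depends on this estimate, since
    -- success is part of the condition.
    ∀ j, (arrival C T (fun x => (⟨naming D.c l x, h x⟩ : Fin D.c)) 8 j).isSome = true ∧
      ((meet (w := w) (v := v) (fun x => (⟨naming D.c l x, h x⟩ : Fin D.c)) j).getLeft?.all fun d =>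
        (arrival C T (fun x => (⟨naming D.c l x, h x⟩ : Fin D.c)) 8
          (Sum.map C.link T.link j)).any (same (D.link d))) = true

instance (C : Picture (.annulus w v)) (T : Picture (.disk v)) (D : Picture (.disk w)) (l : List ℕ) :
    Decidable (C.Fills T D l) := by
  unfold Fills; infer_instance

/-- The ends of strands on the boundary of a disk. -/
abbrev diskPts (n : ℕ) : List (Fin n) := List.finRange n

/-- The ends of strands on the boundary of a disk with a hole. -/
abbrev annulusPts (n k : ℕ) : List (Fin n ⊕ Fin k) :=
  (List.finRange n).map .inl ++ (List.finRange k).map .inr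

theorem across_eq_meet {C : Picture (.annulus w v)} {T : Picture (.disk v)} {D : Picture (.disk w)}
    (hC : C.IsDiagram (annulusPts n k)) (hT : T.IsDiagram (diskPts k)) (hD : D.IsDiagram (diskPts n))
    (f : Fin C.c ⊕ Fin T.c ≃ Fin D.c) (j) :
    across (C.diagram hC) (T.diagram hT) (D.diagram hD) f j = meet f j := by
  rcases j with ((i | j) | ⟨x, p⟩) | (j | ⟨x, p⟩) <;> rfl

/-- Each recursive call of `arrival` is one application of `Arrives.pass`; running out of the bound
gives `none`, never a wrong dart. -/
theorem arrives_of_arrival {C : Picture (.annulus w v)} {T : Picture (.disk v)}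
    {D : Picture (.disk w)}
    (hC : C.IsDiagram (annulusPts n k)) (hT : T.IsDiagram (diskPts k)) (hD : D.IsDiagram (diskPts n))
    (f : Fin C.c ⊕ Fin T.c ≃ Fin D.c) (m : ℕ) (j d) (h : arrival C T f m j = some d) :
    Arrives (C.diagram hC) (T.diagram hT) (D.diagram hD) f j d := by
  induction m generalizing j with
  | zero => simp [arrival] at h
  | succ m ih =>
    rw [arrival] at h
    have hj := across_eq_meet hC hT hD f j
    split at h
    · next d' e =>
      obtain rfl := Option.some.inj h
      exact .here (hj.trans e)
    · next j' e => exact .pass (hj.trans e) (ih _ h)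

theorem Fills.isFilling {C : Picture (.annulus w v)} {T : Picture (.disk v)} {D : Picture (.disk w)}
    {l : List ℕ} (h : C.Fills T D l) (hC : C.IsDiagram (annulusPts n k))
    (hT : T.IsDiagram (diskPts k)) (hD : D.IsDiagram (diskPts n)) :
    IsFilling (C.diagram hC) (T.diagram hT) (D.diagram hD) := by
  obtain ⟨hlt, hbij, hsign, hj⟩ := h
  have key : ∀ (j : Dart (.annulus w v) (Fin C.c) ⊕ Dart (.disk v) (Fin T.c))
      (d : Dart (.disk w) (Fin D.c)),
      meet (fun x => (⟨naming D.c l x, hlt x⟩ : Fin D.c)) j = .inl d →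
        arrival C T (fun x => (⟨naming D.c l x, hlt x⟩ : Fin D.c)) 8 (Sum.map C.link T.link j) =
          some (D.link d) := by
    intro j d e
    have h := (hj j).2
    rw [e, Sum.getLeft?_inl, Option.all_some, Option.any_eq_true] at h
    obtain ⟨d', hd', e'⟩ := h
    rw [hd', same_iff.1 e']
  let f := Equiv.ofBijective _ hbij
  refine ⟨f, hsign, fun j d e => ?_, fun j => ?_⟩
  · exact arrives_of_arrival hC hT hD f 8 _ _
      (key j d ((across_eq_meet hC hT hD f j).symm.trans e))
  · obtain ⟨d, hd⟩ := Option.isSome_iff_exists.1 (hj j).1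
    exact ⟨d, arrives_of_arrival hC hT hD f 8 _ _ hd⟩

/-- The other end of an edge, where crossings are named by natural numbers. -/
def linkNamed (D : Picture (.disk w)) : Dart (.disk w) ℕ → Dart (.disk w) ℕ
  | .inl i => Sum.map id (Prod.map Fin.val id) (D.link (.inl i))
  | .inr (x, p) =>
    if h : x < D.c then Sum.map id (Prod.map Fin.val id) (D.link (.inr (⟨x, h⟩, p))) else .inr (x, p)

/-- The part of `D` outside the smaller disk that contains `T`, whose crossings are named in `l`. It is
meaningful if `D` contains `T` and no edge of `T` has both ends on the boundary. -/
def cut (D : Picture (.disk w)) (T : Picture (.disk v)) (l : List ℕ) : Picture (.annulus w v) where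
  c := D.c - T.c
  sign x := (List.ofFn D.sign).getD (naming D.c l (.inl x : _ ⊕ Fin T.c)) true
  link d :=
    let start : Dart (.disk w) ℕ :=
      match d with
      | .inl (.inl i) => .inl i
      | .inr (x, p) => .inr (naming D.c l (.inl x : _ ⊕ Fin T.c), p)
      -- The edge of `D` that leaves the smaller disk at `j` is the one at the dart of `T` joined to
      -- `j`.
      | .inl (.inr j) =>
        match T.link (.inl j) with
        | .inr (y, p) => .inr (naming D.c l (.inr y : Fin (D.c - T.c) ⊕ _), p)
        | .inl _ => .inr (D.c, .overIn)
    match D.linkNamed start with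
    | .inl i => .inl (.inl i)
    | .inr (x, p) =>
      match (List.finRange (D.c - T.c)).find? fun y =>
        Nat.beq (naming D.c l (.inl y : _ ⊕ Fin T.c)) x with
      | some y => .inr (y, p)
      | none =>
        match (List.finRange T.c).find? fun y =>
          Nat.beq (naming D.c l (.inr y : Fin (D.c - T.c) ⊕ _)) x with
        -- The default `d` would be a fixed point of the link. This contradicts the orientation
        -- condition in `IsDiagram`, so a meaningless cut is rejected there.
        | none => d
        | some y =>
          match T.link (.inr (y, p)) with
          | .inl j => .inl (.inr j)
          | .inr _ => d

end Picture

/-! ### Pictures of the moves -/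

/-- Pictures of the two sides of a move. -/
structure MovePictures where
  {n : ℕ}
  w : Fin n → Bool
  before : Picture (.disk w)
  after : Picture (.disk w)

/-- See `omega1`. -/
@[reducible] def pictures1 (sign overFirst : Bool) : MovePictures where
  w := ![true, false]
  before := .ofStrands 0 ![] [(0, [], 1)]
  after := .ofStrands 1 ![sign] [(0, [(0, overFirst), (0, !overFirst)], 1)]

/-- See `omega2parallel`. -/
@[reducible] def pictures2parallel (westOver : Bool) : MovePictures where
  w := ![true, true, false, false]
  before := .ofStrands 0 ![] [(0, [], 3), (1, [], 2)]
  after := .ofStrands 2 ![westOver, !westOver]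
    [(0, [(0, westOver), (1, westOver)], 3), (1, [(0, !westOver), (1, !westOver)], 2)]

/-- See `omega2counterclockwise`. -/
@[reducible] def pictures2counterclockwise : MovePictures where
  w := ![true, false, true, false]
  before := .ofStrands 0 ![] [(0, [], 3), (2, [], 1)]
  after := .ofStrands 2 ![false, true] [(0, [(0, true), (1, true)], 3), (2, [(1, false), (0, false)], 1)]

/-- See `omega2clockwise`. -/
@[reducible] def pictures2clockwise : MovePictures where
  w := ![false, true, false, true]
  before := .ofStrands 0 ![] [(3, [], 0), (1, [], 2)]
  after := .ofStrands 2 ![false, true] [(3, [(1, true), (0, true)], 0), (1, [(0, false), (1, false)], 2)]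

/-- See `omega3`. -/
@[reducible] def pictures3 (tm tb mb : Bool) : MovePictures where
  w := omega3word tm tb mb
  before := .ofStrands 3 ![tm, tb, mb] (omega3strands tm tb mb false)
  after := .ofStrands 3 ![tm, tb, mb] (omega3strands tm tb mb true)

/-- Pictures of the sixteen moves, see `Move.toLocalMove`. -/
@[reducible] def Move.pictures : Move → MovePictures
  | .omega1a => pictures1 true true
  | .omega1b => pictures1 true false
  | .omega1c => pictures1 false false
  | .omega1d => pictures1 false true
  | .omega2a => pictures2parallel true
  | .omega2b => pictures2parallel false
  | .omega2c => pictures2counterclockwise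
  | .omega2d => pictures2clockwise
  | .omega3a => pictures3 true false true
  | .omega3b => pictures3 true true true
  | .omega3c => pictures3 false false true
  | .omega3d => pictures3 true true false
  | .omega3e => pictures3 false true true
  | .omega3f => pictures3 true false false
  | .omega3g => pictures3 false false false
  | .omega3h => pictures3 false true false

theorem Move.pictures_isDiagram (m : Move) :
    m.pictures.before.IsDiagram (Picture.diskPts _) ∧
      m.pictures.after.IsDiagram (Picture.diskPts _) := by
  cases m <;> decide +kernel

/-- All other fields of a diagram are proofs. Heterogeneous equality is needed because the types of
`sign` and `link` depend on the type of crossings. -/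
theorem Picture.eq_diagram {B : Boundary} [Fintype B.pt] [Coded B.pt] {D : Diagram B} {P : Picture B}
    {pts : List B.pt} (h : P.IsDiagram pts) (hX : D.X = Fin P.c) (hsign : HEq D.sign P.sign)
    (hlink : HEq D.link P.link) : D = P.diagram h := by
  obtain ⟨X, sign, link, _, _, _, _⟩ := D
  change X = Fin P.c at hX
  subst hX
  replace hsign : sign = P.sign := eq_of_heq hsign
  replace hlink : link = P.link := eq_of_heq hlink
  subst hsign hlink
  rfl

/-- The moves and their pictures differ only in the procedure that decides equality of darts. -/
theorem otherEnd_eq {α : Type} (i j : DecidableEq α) (E : List (α × α)) :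
    @otherEnd α i E = @otherEnd α j E := by
  rw [Subsingleton.elim i j]

/-- The move `m` can be realized by moves from `S`. -/
def Derivable (S : Set Move) (m : Move) : Prop := Realizable S m.toLocalMove.before m.toLocalMove.after

theorem Derivable.of_mem {S : Set Move} {m : Move} (h : m ∈ S) : Derivable S m := .move h

theorem derivable_iff_realizable_pictures (S : Set Move) (m : Move) : Derivable S m ↔
    Realizable S (m.pictures.before.diagram m.pictures_isDiagram.1)
      (m.pictures.after.diagram m.pictures_isDiagram.2) := by
  have h := m.pictures_isDiagram
  cases m <;> exact iff_of_eq (congrArg₂ (Realizable S)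
    (Picture.eq_diagram h.1 rfl HEq.rfl (heq_of_eq (otherEnd_eq _ _ _)))
    (Picture.eq_diagram h.2 rfl HEq.rfl (heq_of_eq (otherEnd_eq _ _ _))))

/-! ### Derivations -/

/-- Replacing the part of `P` that looks like one side of `m` by the other side gives `Q`. The crossings
of the side of `m` with more crossings have the names in `l`. -/
def Replaces (m : Move) (l : List ℕ) {n : ℕ} {w : Fin n → Bool} (P Q : Picture (.disk w)) : Prop :=
  -- The surroundings are cut out of the side `after`, where every strand of the move passes a
  -- crossing, so that names of crossings locate the disk. Bare strands, as in `before` for types 1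
  -- and 2, would not.
  (Q.cut m.pictures.after l).IsDiagram (Picture.annulusPts _ _) ∧
  -- The side `before` has no crossings for types 1 and 2, and the same three names as `after` for
  -- type 3.
  (Q.cut m.pictures.after l).Fills m.pictures.before P (l.take m.pictures.before.c) ∧
  (Q.cut m.pictures.after l).Fills m.pictures.after Q l

instance (m : Move) (l : List ℕ) {n : ℕ} {w : Fin n → Bool} (P Q : Picture (.disk w)) :
    Decidable (Replaces m l P Q) := by
  unfold Replaces; infer_instance

theorem Replaces.realizable {m : Move} {l : List ℕ} {n : ℕ} {w : Fin n → Bool}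
    {P Q : Picture (.disk w)} (h : Replaces m l P Q) (hP : P.IsDiagram (Picture.diskPts n))
    (hQ : Q.IsDiagram (Picture.diskPts n)) {S : Set Move} (hm : Derivable S m) :
    Realizable S (P.diagram hP) (Q.diagram hQ) :=
  .inside (h.2.1.isFilling h.1 m.pictures_isDiagram.1 hP)
    (h.2.2.isFilling h.1 m.pictures_isDiagram.2 hQ) ((derivable_iff_realizable_pictures S m).1 hm)

/-- One step of a derivation: the move that is applied, whether it is applied in the forward direction,
the names of the crossings of the move (before the step if it is applied backwards, and after
it otherwise), and the result. -/
structure Step {n : ℕ} (w : Fin n → Bool) where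
  move : Move
  forward : Bool
  names : List ℕ
  result : Picture (.disk w)

variable {n : ℕ} {w : Fin n → Bool}

/-- The steps can be applied one after the other, starting with `P`. -/
def IsDerivation : Picture (.disk w) → List (Step w) → Bool
  | _, [] => true
  | P, s :: L => decide (s.result.IsDiagram (Picture.diskPts n)) &&
      (bif s.forward then decide (Replaces s.move s.names P s.result)
        else decide (Replaces s.move s.names s.result P)) &&
      IsDerivation s.result L

/-- The last picture of a derivation that starts with `P`. -/
@[reducible] def lastPicture : Picture (.disk w) → List (Step w) → Picture (.disk w)
  | P, [] => P
  | _, s :: L => lastPicture s.result L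

theorem Realizable.of_isDerivation {S : Set Move} {P Q : Picture (.disk w)} (L : List (Step w))
    (hP : P.IsDiagram (Picture.diskPts n)) (hQ : Q.IsDiagram (Picture.diskPts n))
    (hL : IsDerivation P L = true) (hlast : lastPicture P L = Q)
    (hS : ∀ s ∈ L, Derivable S s.move) : Realizable S (P.diagram hP) (Q.diagram hQ) := by
  induction L generalizing P with
  | nil =>
    obtain rfl : P = Q := hlast
    exact .isotopy ⟨Equiv.refl _, fun _ => rfl, fun d => by simp⟩
  | cons s L ih =>
    simp only [IsDerivation, Bool.and_eq_true, decide_eq_true_eq] at hL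
    obtain ⟨⟨hs, hrep⟩, hL⟩ := hL
    refine .trans ?_ (ih hs hL hlast fun t ht => hS t (List.mem_cons_of_mem _ ht))
    have hm := hS s List.mem_cons_self
    cases hf : s.forward <;> rw [hf] at hrep
    · exact .symm (Replaces.realizable (of_decide_eq_true hrep) _ _ hm)
    · exact Replaces.realizable (of_decide_eq_true hrep) _ _ hm

theorem Derivable.of_steps {S : Set Move} (m : Move) (L : List (Step m.pictures.w))
    (hL : IsDerivation m.pictures.before L = true)
    (hlast : lastPicture m.pictures.before L = m.pictures.after)
    (hS : (L.map Step.move).Forall (Derivable S)) : Derivable S m := by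
  rw [derivable_iff_realizable_pictures]
  refine .of_isDerivation L _ _ hL hlast fun s hs => ?_
  exact List.forall_iff_forall_mem.1 hS _ (List.mem_map_of_mem hs)

open Move

/-! ### Derivations of moves of types 1 and 2 with the first coherently oriented triangle -/

/-- The loop of a kink is pushed over the strand that leaves it. The crossing of the kink and the
bigon form a coherent triangle, and moving through it leaves two free kinks inside a third one,
which has the same sign as the first but the other direction. -/
theorem omega1a_of_1b_1d_2a_3a {S : Set Move} (h1b : Derivable S omega1b)
    (h1d : Derivable S omega1d) (h2a : Derivable S omega2a) (h3a : Derivable S omega3a) :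
    Derivable S omega1a :=
  .of_steps _ [
    ⟨omega1b, true, [0], .ofStrands 1 ![true]
      [(0, [(0, false), (0, true)], 1)]⟩,
    ⟨omega2a, true, [1, 2], .ofStrands 3 ![true, true, false]
      [(0, [(0, false), (1, true), (2, true), (0, true), (1, false), (2, false)], 1)]⟩,
    -- Crossings 0 and 2 now belong to free kinks of types Ω1b and Ω1d, inside the loop at crossing
    -- 1.
    ⟨omega3a, true, [0, 2, 1], .ofStrands 3 ![true, true, false]
      [(0, [(1, true), (0, false), (0, true), (2, true), (2, false), (1, false)], 1)]⟩,
    ⟨omega1d, false, [2], .ofStrands 2 ![true, true]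
      [(0, [(1, true), (0, false), (0, true), (1, false)], 1)]⟩,
    ⟨omega1b, false, [0], omega1a.pictures.after⟩]
    (by decide +kernel) rfl ⟨h1b, h2a, h3a, h1d, h1b⟩

theorem omega1a_of_1b_1d_2b_3a {S : Set Move} (h1b : Derivable S omega1b)
    (h1d : Derivable S omega1d) (h2b : Derivable S omega2b) (h3a : Derivable S omega3a) :
    Derivable S omega1a :=
  .of_steps _ [
    ⟨omega1b, true, [0], .ofStrands 1 ![true]
      [(0, [(0, false), (0, true)], 1)]⟩,
    ⟨omega2b, true, [1, 2], .ofStrands 3 ![true, false, true]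
      [(0, [(1, true), (2, true), (0, false), (1, false), (2, false), (0, true)], 1)]⟩,
    ⟨omega3a, true, [2, 1, 0], .ofStrands 3 ![true, false, true]
      [(0, [(2, true), (1, true), (1, false), (0, false), (0, true), (2, false)], 1)]⟩,
    ⟨omega1d, false, [1], .ofStrands 2 ![true, true]
      [(0, [(1, true), (0, false), (0, true), (1, false)], 1)]⟩,
    ⟨omega1b, false, [0], omega1a.pictures.after⟩]
    (by decide +kernel) rfl ⟨h1b, h2b, h3a, h1d, h1b⟩

/-- The loop of the kink is parallel to the other strand where they meet. After Ω3a that strand no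
longer meets the loop, but crosses the kinked strand before and after the kink. -/
theorem omega2c_of_1a_2a_3a {S : Set Move} (h1a : Derivable S omega1a) (h2a : Derivable S omega2a)
    (h3a : Derivable S omega3a) :
    Derivable S omega2c :=
  .of_steps _ [
    ⟨omega1a, true, [0], .ofStrands 1 ![true]
      [(0, [], 3), (2, [(0, true), (0, false)], 1)]⟩,
    ⟨omega2a, true, [2, 1], .ofStrands 3 ![true, false, true]
      [(0, [(2, true), (1, true)], 3), (2, [(0, true), (2, false), (1, false), (0, false)], 1)]⟩,
    ⟨omega3a, false, [2, 1, 0], .ofStrands 3 ![true, false, true]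
      [(0, [(1, true), (2, true)], 3), (2, [(2, false), (0, true), (0, false), (1, false)], 1)]⟩,
    ⟨omega1a, false, [0], omega2c.pictures.after⟩]
    (by decide +kernel) rfl ⟨h1a, h2a, h3a, h1a⟩

theorem omega2c_of_1a_2b_3a {S : Set Move} (h1a : Derivable S omega1a) (h2b : Derivable S omega2b)
    (h3a : Derivable S omega3a) :
    Derivable S omega2c :=
  .of_steps _ [
    ⟨omega1a, true, [0], .ofStrands 1 ![true]
      [(0, [(0, true), (0, false)], 3), (2, [], 1)]⟩,
    ⟨omega2b, true, [1, 2], .ofStrands 3 ![true, false, true]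
      [(0, [(0, true), (1, true), (2, true), (0, false)], 3), (2, [(1, false), (2, false)], 1)]⟩,
    ⟨omega3a, false, [0, 1, 2], .ofStrands 3 ![true, false, true]
      [(0, [(1, true), (0, true), (0, false), (2, true)], 3), (2, [(2, false), (1, false)], 1)]⟩,
    ⟨omega1a, false, [0], omega2c.pictures.after⟩]
    (by decide +kernel) rfl ⟨h1a, h2b, h3a, h1a⟩

/-- Ω2c of a strand with itself gives nested kinks of opposite signs; the inner one has type Ω1a. -/
theorem omega1d_of_1a_2c {S : Set Move} (h1a : Derivable S omega1a) (h2c : Derivable S omega2c) :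
    Derivable S omega1d :=
  .of_steps _ [
    ⟨omega2c, true, [0, 1], .ofStrands 2 ![false, true]
      [(0, [(0, true), (1, true), (1, false), (0, false)], 1)]⟩,
    ⟨omega1a, false, [1], omega1d.pictures.after⟩]
    (by decide +kernel) rfl ⟨h2c, h1a⟩

theorem omega2a_of_1a_1d_2c_3a {S : Set Move} (h1a : Derivable S omega1a)
    (h1d : Derivable S omega1d) (h2c : Derivable S omega2c) (h3a : Derivable S omega3a) :
    Derivable S omega2a :=
  .of_steps _ [
    ⟨omega1d, true, [0], .ofStrands 1 ![false]
      [(0, [], 3), (1, [(0, true), (0, false)], 2)]⟩,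
    ⟨omega2c, true, [2, 1], .ofStrands 3 ![false, true, false]
      [(0, [(2, true), (1, true)], 3), (1, [(0, true), (1, false), (2, false), (0, false)], 2)]⟩,
    -- A second kink inside the loop of the first one reverses the direction once more. Moving the
    -- other strand across its crossing leaves that strand in a bigon with the original direction,
    -- while the two kinks form a bigon of type Ω2c.
    ⟨omega1a, true, [2], .ofStrands 4 ![false, true, true, false]
      [(0, [(3, true), (1, true)], 3),
        (1, [(0, true), (1, false), (2, true), (2, false), (3, false), (0, false)], 2)]⟩,
    ⟨omega3a, true, [1, 3, 2], .ofStrands 4 ![false, true, true, false]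
      [(0, [(1, true), (3, true)], 3),
        (1, [(0, true), (2, true), (1, false), (3, false), (2, false), (0, false)], 2)]⟩,
    ⟨omega2c, false, [0, 2], omega2a.pictures.after⟩]
    (by decide +kernel) rfl ⟨h1d, h2c, h1a, h3a, h2c⟩

theorem omega2b_of_1a_1d_2c_3a {S : Set Move} (h1a : Derivable S omega1a)
    (h1d : Derivable S omega1d) (h2c : Derivable S omega2c) (h3a : Derivable S omega3a) :
    Derivable S omega2b :=
  .of_steps _ [
    ⟨omega1d, true, [0], .ofStrands 1 ![false]
      [(0, [], 3), (1, [(0, true), (0, false)], 2)]⟩,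
    ⟨omega2c, true, [1, 2], .ofStrands 3 ![false, false, true]
      [(0, [(2, false), (1, false)], 3), (1, [(0, true), (1, true), (2, true), (0, false)], 2)]⟩,
    ⟨omega1a, true, [2], .ofStrands 4 ![false, false, true, true]
      [(0, [(3, false), (1, false)], 3),
        (1, [(0, true), (1, true), (2, true), (2, false), (3, true), (0, false)], 2)]⟩,
    ⟨omega3a, true, [2, 1, 3], .ofStrands 4 ![false, false, true, true]
      [(0, [(1, false), (3, false)], 3),
        (1, [(0, true), (2, true), (1, true), (3, true), (2, false), (0, false)], 2)]⟩,
    ⟨omega2c, false, [0, 2], omega2b.pictures.after⟩]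
    (by decide +kernel) rfl ⟨h1d, h2c, h1a, h3a, h2c⟩

/-- The trade of `omega1a_of_1b_1d_2a_3a`, with the outgoing strand passing over the loop instead of
under it: the free kinks have types Ω1c and Ω1a. -/
theorem omega1b_of_1a_1c_2a_3a {S : Set Move} (h1a : Derivable S omega1a)
    (h1c : Derivable S omega1c) (h2a : Derivable S omega2a) (h3a : Derivable S omega3a) :
    Derivable S omega1b :=
  .of_steps _ [
    ⟨omega1a, true, [0], .ofStrands 1 ![true]
      [(0, [(0, true), (0, false)], 1)]⟩,
    ⟨omega2a, true, [1, 2], .ofStrands 3 ![true, true, false]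
      [(0, [(0, true), (1, false), (2, false), (0, false), (1, true), (2, true)], 1)]⟩,
    ⟨omega3a, false, [1, 2, 0], .ofStrands 3 ![true, true, false]
      [(0, [(1, false), (0, true), (0, false), (2, false), (2, true), (1, true)], 1)]⟩,
    ⟨omega1c, false, [2], .ofStrands 2 ![true, true]
      [(0, [(1, false), (0, true), (0, false), (1, true)], 1)]⟩,
    ⟨omega1a, false, [0], omega1b.pictures.after⟩]
    (by decide +kernel) rfl ⟨h1a, h2a, h3a, h1c, h1a⟩

theorem omega2d_of_1b_2a_3a {S : Set Move} (h1b : Derivable S omega1b) (h2a : Derivable S omega2a)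
    (h3a : Derivable S omega3a) :
    Derivable S omega2d :=
  .of_steps _ [
    ⟨omega1b, true, [0], .ofStrands 1 ![true]
      [(1, [], 2), (3, [(0, false), (0, true)], 0)]⟩,
    ⟨omega2a, true, [2, 1], .ofStrands 3 ![true, false, true]
      [(1, [(2, false), (1, false)], 2), (3, [(0, false), (2, true), (1, true), (0, true)], 0)]⟩,
    ⟨omega3a, true, [0, 1, 2], .ofStrands 3 ![true, false, true]
      [(1, [(1, false), (2, false)], 2), (3, [(2, true), (0, false), (0, true), (1, true)], 0)]⟩,
    ⟨omega1b, false, [0], omega2d.pictures.after⟩]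
    (by decide +kernel) rfl ⟨h1b, h2a, h3a, h1b⟩

theorem omega1c_of_1b_2d {S : Set Move} (h1b : Derivable S omega1b) (h2d : Derivable S omega2d) :
    Derivable S omega1c :=
  .of_steps _ [
    ⟨omega2d, true, [0, 1], .ofStrands 2 ![false, true]
      [(0, [(0, false), (1, false), (1, true), (0, true)], 1)]⟩,
    ⟨omega1b, false, [1], omega1c.pictures.after⟩]
    (by decide +kernel) rfl ⟨h2d, h1b⟩

/-! ### Derivations of moves of types 1 and 2 with the second coherently oriented triangle -/

/-- This is `omega1a_of_1b_1d_2b_3a` with all crossings switched. -/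
theorem omega1c_of_1b_1d_2a_3h {S : Set Move} (h1b : Derivable S omega1b)
    (h1d : Derivable S omega1d) (h2a : Derivable S omega2a) (h3h : Derivable S omega3h) :
    Derivable S omega1c :=
  .of_steps _ [
    ⟨omega1d, true, [0], .ofStrands 1 ![false]
      [(0, [(0, true), (0, false)], 1)]⟩,
    ⟨omega2a, true, [1, 2], .ofStrands 3 ![false, true, false]
      [(0, [(1, false), (2, false), (0, true), (1, true), (2, true), (0, false)], 1)]⟩,
    ⟨omega3h, true, [0, 1, 2], .ofStrands 3 ![false, true, false]
      [(0, [(2, false), (1, false), (1, true), (0, true), (0, false), (2, true)], 1)]⟩,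
    ⟨omega1b, false, [1], .ofStrands 2 ![false, false]
      [(0, [(1, false), (0, true), (0, false), (1, true)], 1)]⟩,
    ⟨omega1d, false, [0], omega1c.pictures.after⟩]
    (by decide +kernel) rfl ⟨h1d, h2a, h3h, h1b, h1d⟩

theorem omega1c_of_1b_1d_2b_3h {S : Set Move} (h1b : Derivable S omega1b)
    (h1d : Derivable S omega1d) (h2b : Derivable S omega2b) (h3h : Derivable S omega3h) :
    Derivable S omega1c :=
  .of_steps _ [
    ⟨omega1d, true, [0], .ofStrands 1 ![false]
      [(0, [(0, true), (0, false)], 1)]⟩,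
    ⟨omega2b, true, [1, 2], .ofStrands 3 ![false, false, true]
      [(0, [(0, true), (1, false), (2, false), (0, false), (1, true), (2, true)], 1)]⟩,
    ⟨omega3h, true, [1, 2, 0], .ofStrands 3 ![false, false, true]
      [(0, [(1, false), (0, true), (0, false), (2, false), (2, true), (1, true)], 1)]⟩,
    ⟨omega1b, false, [2], .ofStrands 2 ![false, false]
      [(0, [(1, false), (0, true), (0, false), (1, true)], 1)]⟩,
    ⟨omega1d, false, [0], omega1c.pictures.after⟩]
    (by decide +kernel) rfl ⟨h1d, h2b, h3h, h1b, h1d⟩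

theorem omega2c_of_1c_2a_3h {S : Set Move} (h1c : Derivable S omega1c) (h2a : Derivable S omega2a)
    (h3h : Derivable S omega3h) :
    Derivable S omega2c :=
  .of_steps _ [
    ⟨omega1c, true, [0], .ofStrands 1 ![false]
      [(0, [], 3), (2, [(0, false), (0, true)], 1)]⟩,
    ⟨omega2a, true, [2, 1], .ofStrands 3 ![false, false, true]
      [(0, [(2, true), (1, true)], 3), (2, [(0, false), (2, false), (1, false), (0, true)], 1)]⟩,
    ⟨omega3h, false, [1, 2, 0], .ofStrands 3 ![false, false, true]
      [(0, [(1, true), (2, true)], 3), (2, [(2, false), (0, false), (0, true), (1, false)], 1)]⟩,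
    ⟨omega1c, false, [0], omega2c.pictures.after⟩]
    (by decide +kernel) rfl ⟨h1c, h2a, h3h, h1c⟩

theorem omega2c_of_1c_2b_3h {S : Set Move} (h1c : Derivable S omega1c) (h2b : Derivable S omega2b)
    (h3h : Derivable S omega3h) :
    Derivable S omega2c :=
  .of_steps _ [
    ⟨omega1c, true, [0], .ofStrands 1 ![false]
      [(0, [(0, false), (0, true)], 3), (2, [], 1)]⟩,
    ⟨omega2b, true, [1, 2], .ofStrands 3 ![false, false, true]
      [(0, [(0, false), (1, true), (2, true), (0, true)], 3), (2, [(1, false), (2, false)], 1)]⟩,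
    ⟨omega3h, false, [0, 2, 1], .ofStrands 3 ![false, false, true]
      [(0, [(1, true), (0, false), (0, true), (2, true)], 3), (2, [(2, false), (1, false)], 1)]⟩,
    ⟨omega1c, false, [0], omega2c.pictures.after⟩]
    (by decide +kernel) rfl ⟨h1c, h2b, h3h, h1c⟩

theorem omega1b_of_1c_2c {S : Set Move} (h1c : Derivable S omega1c) (h2c : Derivable S omega2c) :
    Derivable S omega1b :=
  .of_steps _ [
    ⟨omega2c, true, [1, 0], .ofStrands 2 ![true, false]
      [(0, [(0, false), (1, false), (1, true), (0, true)], 1)]⟩,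
    ⟨omega1c, false, [1], omega1b.pictures.after⟩]
    (by decide +kernel) rfl ⟨h2c, h1c⟩

theorem omega2a_of_1b_1c_2c_3h {S : Set Move} (h1b : Derivable S omega1b)
    (h1c : Derivable S omega1c) (h2c : Derivable S omega2c) (h3h : Derivable S omega3h) :
    Derivable S omega2a :=
  .of_steps _ [
    ⟨omega1b, true, [0], .ofStrands 1 ![true]
      [(0, [], 3), (1, [(0, false), (0, true)], 2)]⟩,
    ⟨omega2c, true, [2, 1], .ofStrands 3 ![true, true, false]
      [(0, [(2, true), (1, true)], 3), (1, [(0, false), (1, false), (2, false), (0, true)], 2)]⟩,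
    ⟨omega1c, true, [2], .ofStrands 4 ![true, true, false, false]
      [(0, [(3, true), (1, true)], 3),
        (1, [(0, false), (1, false), (2, false), (2, true), (3, false), (0, true)], 2)]⟩,
    ⟨omega3h, true, [3, 1, 2], .ofStrands 4 ![true, true, false, false]
      [(0, [(1, true), (3, true)], 3),
        (1, [(0, false), (2, false), (1, false), (3, false), (2, true), (0, true)], 2)]⟩,
    ⟨omega2c, false, [2, 0], omega2a.pictures.after⟩]
    (by decide +kernel) rfl ⟨h1b, h2c, h1c, h3h, h2c⟩

theorem omega2b_of_1b_1c_2c_3h {S : Set Move} (h1b : Derivable S omega1b)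
    (h1c : Derivable S omega1c) (h2c : Derivable S omega2c) (h3h : Derivable S omega3h) :
    Derivable S omega2b :=
  .of_steps _ [
    ⟨omega1b, true, [0], .ofStrands 1 ![true]
      [(0, [], 3), (1, [(0, false), (0, true)], 2)]⟩,
    ⟨omega2c, true, [1, 2], .ofStrands 3 ![true, false, true]
      [(0, [(2, false), (1, false)], 3), (1, [(0, false), (1, true), (2, true), (0, true)], 2)]⟩,
    ⟨omega1c, true, [2], .ofStrands 4 ![true, false, false, true]
      [(0, [(3, false), (1, false)], 3),
        (1, [(0, false), (1, true), (2, false), (2, true), (3, true), (0, true)], 2)]⟩,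
    ⟨omega3h, true, [2, 3, 1], .ofStrands 4 ![true, false, false, true]
      [(0, [(1, false), (3, false)], 3),
        (1, [(0, false), (2, false), (1, true), (3, true), (2, true), (0, true)], 2)]⟩,
    ⟨omega2c, false, [2, 0], omega2b.pictures.after⟩]
    (by decide +kernel) rfl ⟨h1b, h2c, h1c, h3h, h2c⟩

theorem omega1d_of_1a_1c_2a_3h {S : Set Move} (h1a : Derivable S omega1a)
    (h1c : Derivable S omega1c) (h2a : Derivable S omega2a) (h3h : Derivable S omega3h) :
    Derivable S omega1d :=
  .of_steps _ [
    ⟨omega1c, true, [0], .ofStrands 1 ![false]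
      [(0, [(0, false), (0, true)], 1)]⟩,
    ⟨omega2a, true, [1, 2], .ofStrands 3 ![false, true, false]
      [(0, [(1, true), (2, true), (0, false), (1, false), (2, false), (0, true)], 1)]⟩,
    ⟨omega3h, false, [2, 1, 0], .ofStrands 3 ![false, true, false]
      [(0, [(2, true), (1, true), (1, false), (0, false), (0, true), (2, false)], 1)]⟩,
    ⟨omega1a, false, [1], .ofStrands 2 ![false, false]
      [(0, [(1, true), (0, false), (0, true), (1, false)], 1)]⟩,
    ⟨omega1c, false, [0], omega1d.pictures.after⟩]
    (by decide +kernel) rfl ⟨h1c, h2a, h3h, h1a, h1c⟩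

theorem omega2d_of_1d_2a_3h {S : Set Move} (h1d : Derivable S omega1d) (h2a : Derivable S omega2a)
    (h3h : Derivable S omega3h) :
    Derivable S omega2d :=
  .of_steps _ [
    ⟨omega1d, true, [0], .ofStrands 1 ![false]
      [(1, [], 2), (3, [(0, true), (0, false)], 0)]⟩,
    ⟨omega2a, true, [2, 1], .ofStrands 3 ![false, false, true]
      [(1, [(2, false), (1, false)], 2), (3, [(0, true), (2, true), (1, true), (0, false)], 0)]⟩,
    ⟨omega3h, true, [0, 2, 1], .ofStrands 3 ![false, false, true]
      [(1, [(1, false), (2, false)], 2), (3, [(2, true), (0, true), (0, false), (1, true)], 0)]⟩,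
    ⟨omega1d, false, [0], omega2d.pictures.after⟩]
    (by decide +kernel) rfl ⟨h1d, h2a, h3h, h1d⟩

theorem omega1a_of_1d_2d {S : Set Move} (h1d : Derivable S omega1d) (h2d : Derivable S omega2d) :
    Derivable S omega1a :=
  .of_steps _ [
    ⟨omega2d, true, [1, 0], .ofStrands 2 ![true, false]
      [(0, [(0, true), (1, true), (1, false), (0, false)], 1)]⟩,
    ⟨omega1d, false, [1], omega1a.pictures.after⟩]
    (by decide +kernel) rfl ⟨h2d, h1d⟩

/-! ### Derivations of moves of type 3 -/

/-- The sign triples of Ω3a and Ω3b differ for top and bottom. Ω2d gives these strands two more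
crossings, 1 and 3, and the negative one, 1, completes a coherent triangle with 0 and 4. After Ω3a
it forms a bigon with the old crossing 2, and when these two are removed, 3 takes the place of 2.
The other derivations of type 3 moves work in the same way; the bigons are antiparallel exactly when
one of the two moves is Ω3a or Ω3h. -/
theorem omega3b_of_2c_2d_3a {S : Set Move} (h2c : Derivable S omega2c) (h2d : Derivable S omega2d)
    (h3a : Derivable S omega3a) :
    Derivable S omega3b :=
  .of_steps _ [
    ⟨omega2d, true, [1, 3], .ofStrands 5 ![true, false, true, true, true]
      [(3, [(3, true), (1, true), (0, true), (2, true)], 0), (4, [(0, false), (4, true)], 1),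
        (5, [(2, false), (4, false), (1, false), (3, false)], 2)]⟩,
    ⟨omega3a, true, [0, 1, 4], .ofStrands 5 ![true, false, true, true, true]
      [(3, [(3, true), (0, true), (1, true), (2, true)], 0), (4, [(4, true), (0, false)], 1),
        (5, [(2, false), (1, false), (4, false), (3, false)], 2)]⟩,
    ⟨omega2c, false, [1, 2], omega3b.pictures.after⟩]
    (by decide +kernel) rfl ⟨h2d, h3a, h2c⟩

theorem omega3c_of_2c_2d_3a {S : Set Move} (h2c : Derivable S omega2c) (h2d : Derivable S omega2d)
    (h3a : Derivable S omega3a) :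
    Derivable S omega3c :=
  .of_steps _ [
    ⟨omega2d, true, [1, 2], .ofStrands 5 ![false, false, true, false, true]
      [(1, [(1, false), (2, false), (4, true), (0, false)], 4), (2, [(4, false), (3, false)], 5),
        (3, [(0, true), (3, true), (2, true), (1, true)], 0)]⟩,
    ⟨omega3a, true, [2, 3, 4], .ofStrands 5 ![false, false, true, false, true]
      [(1, [(1, false), (4, true), (2, false), (0, false)], 4), (2, [(3, false), (4, false)], 5),
        (3, [(0, true), (2, true), (3, true), (1, true)], 0)]⟩,
    ⟨omega2c, false, [0, 2], omega3c.pictures.after⟩]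
    (by decide +kernel) rfl ⟨h2d, h3a, h2c⟩

theorem omega3f_of_2c_2d_3a {S : Set Move} (h2c : Derivable S omega2c) (h2d : Derivable S omega2d)
    (h3a : Derivable S omega3a) :
    Derivable S omega3f :=
  .of_steps _ [
    ⟨omega2c, true, [4, 1], .ofStrands 5 ![true, true, false, false, false]
      [(2, [(3, false), (2, false), (1, false), (4, false)], 5), (3, [(0, true), (2, true)], 0),
        (4, [(4, true), (1, true), (0, false), (3, true)], 1)]⟩,
    ⟨omega3a, false, [0, 2, 1], .ofStrands 5 ![true, true, false, false, false]
      [(2, [(3, false), (1, false), (2, false), (4, false)], 5), (3, [(2, true), (0, true)], 0),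
        (4, [(4, true), (0, false), (1, true), (3, true)], 1)]⟩,
    ⟨omega2d, false, [3, 1], omega3f.pictures.after⟩]
    (by decide +kernel) rfl ⟨h2c, h3a, h2d⟩

theorem omega3d_of_2a_2b_3b {S : Set Move} (h2a : Derivable S omega2a) (h2b : Derivable S omega2b)
    (h3b : Derivable S omega3b) :
    Derivable S omega3d :=
  .of_steps _ [
    ⟨omega2b, true, [4, 1], .ofStrands 5 ![true, true, true, false, false]
      [(3, [(2, true), (0, true)], 0), (4, [(4, false), (1, false), (2, false), (3, false)], 1),
        (5, [(4, true), (1, true), (0, false), (3, true)], 2)]⟩,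
    ⟨omega3b, false, [0, 2, 1], .ofStrands 5 ![true, true, true, false, false]
      [(3, [(0, true), (2, true)], 0), (4, [(4, false), (2, false), (1, false), (3, false)], 1),
        (5, [(4, true), (0, false), (1, true), (3, true)], 2)]⟩,
    ⟨omega2a, false, [1, 3], omega3d.pictures.after⟩]
    (by decide +kernel) rfl ⟨h2b, h3b, h2a⟩

theorem omega3e_of_2a_2b_3b {S : Set Move} (h2a : Derivable S omega2a) (h2b : Derivable S omega2b)
    (h3b : Derivable S omega3b) :
    Derivable S omega3e :=
  .of_steps _ [
    ⟨omega2b, true, [1, 2], .ofStrands 5 ![false, false, true, true, true]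
      [(2, [(1, false), (2, false), (4, true), (0, false)], 5),
        (3, [(1, true), (2, true), (3, true), (0, true)], 0), (4, [(3, false), (4, false)], 1)]⟩,
    ⟨omega3b, true, [2, 3, 4], .ofStrands 5 ![false, false, true, true, true]
      [(2, [(1, false), (4, true), (2, false), (0, false)], 5),
        (3, [(1, true), (3, true), (2, true), (0, true)], 0), (4, [(4, false), (3, false)], 1)]⟩,
    ⟨omega2a, false, [2, 0], omega3e.pictures.after⟩]
    (by decide +kernel) rfl ⟨h2b, h3b, h2a⟩

theorem omega3g_of_2a_2b_3c {S : Set Move} (h2a : Derivable S omega2a) (h2b : Derivable S omega2b)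
    (h3c : Derivable S omega3c) :
    Derivable S omega3g :=
  .of_steps _ [
    ⟨omega2a, true, [1, 4], .ofStrands 5 ![false, true, false, false, false]
      [(1, [(3, false), (2, false), (1, false), (4, false)], 4),
        (2, [(3, true), (0, false), (1, true), (4, true)], 5), (3, [(2, true), (0, true)], 0)]⟩,
    ⟨omega3c, false, [0, 2, 1], .ofStrands 5 ![false, true, false, false, false]
      [(1, [(3, false), (1, false), (2, false), (4, false)], 4),
        (2, [(3, true), (1, true), (0, false), (4, true)], 5), (3, [(0, true), (2, true)], 0)]⟩,
    ⟨omega2b, false, [3, 1], omega3g.pictures.after⟩]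
    (by decide +kernel) rfl ⟨h2a, h3c, h2b⟩

theorem omega3h_of_2c_2d_3d {S : Set Move} (h2c : Derivable S omega2c) (h2d : Derivable S omega2d)
    (h3d : Derivable S omega3d) :
    Derivable S omega3h :=
  .of_steps _ [
    ⟨omega2d, true, [1, 2], .ofStrands 5 ![false, false, true, true, false]
      [(1, [(1, false), (2, false), (4, true), (0, false)], 4),
        (3, [(0, true), (3, true), (2, true), (1, true)], 0), (5, [(3, false), (4, false)], 2)]⟩,
    ⟨omega3d, true, [2, 3, 4], .ofStrands 5 ![false, false, true, true, false]
      [(1, [(1, false), (4, true), (2, false), (0, false)], 4),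
        (3, [(0, true), (2, true), (3, true), (1, true)], 0), (5, [(4, false), (3, false)], 2)]⟩,
    ⟨omega2c, false, [0, 2], omega3h.pictures.after⟩]
    (by decide +kernel) rfl ⟨h2d, h3d, h2c⟩

theorem omega3d_of_2c_2d_3h {S : Set Move} (h2c : Derivable S omega2c) (h2d : Derivable S omega2d)
    (h3h : Derivable S omega3h) :
    Derivable S omega3d :=
  .of_steps _ [
    ⟨omega2d, true, [2, 1], .ofStrands 5 ![true, true, false, true, false]
      [(3, [(1, true), (2, true), (3, true), (0, true)], 0), (4, [(3, false), (4, false)], 1),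
        (5, [(0, false), (4, true), (2, false), (1, false)], 2)]⟩,
    ⟨omega3h, true, [2, 3, 4], .ofStrands 5 ![true, true, false, true, false]
      [(3, [(1, true), (3, true), (2, true), (0, true)], 0), (4, [(4, false), (3, false)], 1),
        (5, [(0, false), (2, false), (4, true), (1, false)], 2)]⟩,
    ⟨omega2c, false, [2, 0], omega3d.pictures.after⟩]
    (by decide +kernel) rfl ⟨h2d, h3h, h2c⟩

theorem omega3b_of_2a_2b_3d {S : Set Move} (h2a : Derivable S omega2a) (h2b : Derivable S omega2b)
    (h3d : Derivable S omega3d) :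
    Derivable S omega3b :=
  .of_steps _ [
    ⟨omega2a, true, [4, 1], .ofStrands 5 ![true, false, true, true, true]
      [(3, [(0, true), (2, true)], 0), (4, [(4, true), (1, true), (0, false), (3, true)], 1),
        (5, [(4, false), (1, false), (2, false), (3, false)], 2)]⟩,
    ⟨omega3d, false, [0, 2, 1], .ofStrands 5 ![true, false, true, true, true]
      [(3, [(2, true), (0, true)], 0), (4, [(4, true), (0, false), (1, true), (3, true)], 1),
        (5, [(4, false), (2, false), (1, false), (3, false)], 2)]⟩,
    ⟨omega2b, false, [1, 3], omega3b.pictures.after⟩]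
    (by decide +kernel) rfl ⟨h2a, h3d, h2b⟩

theorem omega3a_of_2c_2d_3b {S : Set Move} (h2c : Derivable S omega2c) (h2d : Derivable S omega2d)
    (h3b : Derivable S omega3b) :
    Derivable S omega3a :=
  .of_steps _ [
    ⟨omega2d, true, [3, 1], .ofStrands 5 ![true, true, false, false, true]
      [(1, [(3, false), (1, false), (4, false), (2, false)], 4),
        (3, [(2, true), (0, true), (1, true), (3, true)], 0), (5, [(0, false), (4, true)], 2)]⟩,
    ⟨omega3b, true, [0, 1, 4], .ofStrands 5 ![true, true, false, false, true]
      [(1, [(3, false), (4, false), (1, false), (2, false)], 4),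
        (3, [(2, true), (1, true), (0, true), (3, true)], 0), (5, [(4, true), (0, false)], 2)]⟩,
    ⟨omega2c, false, [2, 1], omega3a.pictures.after⟩]
    (by decide +kernel) rfl ⟨h2d, h3b, h2c⟩

/-! ### Generating sets -/

/-- A third type 1 move is necessary besides Ω1a and Ω1d: these two, like all moves of types 2 and
3, preserve the sum of writhe and rotation number, which Ω1b and Ω1c change. -/
theorem types12_of_3a {S : Set Move} (h1a : Derivable S omega1a)
    (h1 : Derivable S omega1b ∨ Derivable S omega1c) (h2 : Derivable S omega2a ∨ Derivable S omega2b)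
    (h3a : Derivable S omega3a) :
    (Derivable S omega1b ∧ Derivable S omega1c ∧ Derivable S omega1d) ∧
      Derivable S omega2a ∧ Derivable S omega2b ∧ Derivable S omega2c ∧ Derivable S omega2d := by
  -- Ω2c comes first, since one parallel type 2 move suffices for it; it then yields the other
  -- parallel one.
  have h2c := h2.elim (omega2c_of_1a_2a_3a h1a · h3a) (omega2c_of_1a_2b_3a h1a · h3a)
  have h1d := omega1d_of_1a_2c h1a h2c
  have h2a := omega2a_of_1a_1d_2c_3a h1a h1d h2c h3a
  have h1b := h1.elim id (omega1b_of_1a_1c_2a_3a h1a · h2a h3a)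
  have h2d := omega2d_of_1b_2a_3a h1b h2a h3a
  exact ⟨⟨h1b, omega1c_of_1b_2d h1b h2d, h1d⟩, h2a,
    omega2b_of_1a_1d_2c_3a h1a h1d h2c h3a, h2c, h2d⟩

theorem types12_of_3h {S : Set Move} (h1c : Derivable S omega1c)
    (h1 : Derivable S omega1d ∨ Derivable S omega1a) (h2 : Derivable S omega2a ∨ Derivable S omega2b)
    (h3h : Derivable S omega3h) :
    (Derivable S omega1a ∧ Derivable S omega1b ∧ Derivable S omega1d) ∧
      Derivable S omega2a ∧ Derivable S omega2b ∧ Derivable S omega2c ∧ Derivable S omega2d := by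
  have h2c := h2.elim (omega2c_of_1c_2a_3h h1c · h3h) (omega2c_of_1c_2b_3h h1c · h3h)
  have h1b := omega1b_of_1c_2c h1c h2c
  have h2a := omega2a_of_1b_1c_2c_3h h1b h1c h2c h3h
  have h1d := h1.elim id (omega1d_of_1a_1c_2a_3h · h1c h2a h3h)
  have h2d := omega2d_of_1d_2a_3h h1d h2a h3h
  exact ⟨⟨omega1a_of_1d_2d h1d h2d, h1b, h1d⟩, h2a,
    omega2b_of_1b_1c_2c_3h h1b h1c h2c h3h, h2c, h2d⟩

/-- The derivations form a spanning tree of the cube of sign triples with root Ω3a: Ω3b, Ω3c and Ω3f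
are adjacent to the root, Ω3d and Ω3e follow Ω3b, Ω3g follows Ω3c, and Ω3h follows Ω3d. -/
theorem isGeneratingSet_of_types12 {S : Set Move}
    (h1 : Derivable S omega1a ∧ Derivable S omega1b ∧ Derivable S omega1c ∧ Derivable S omega1d)
    (h2 : Derivable S omega2a ∧ Derivable S omega2b ∧ Derivable S omega2c ∧ Derivable S omega2d)
    (h3a : Derivable S omega3a) : IsGeneratingSet S := by
  obtain ⟨h2a, h2b, h2c, h2d⟩ := h2
  have h3b := omega3b_of_2c_2d_3a h2c h2d h3a
  have h3c := omega3c_of_2c_2d_3a h2c h2d h3a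
  have h3d := omega3d_of_2a_2b_3b h2a h2b h3b
  intro m
  cases m
  exacts [h1.1, h1.2.1, h1.2.2.1, h1.2.2.2, h2a, h2b, h2c, h2d, h3a, h3b, h3c, h3d,
    omega3e_of_2a_2b_3b h2a h2b h3b, omega3f_of_2c_2d_3a h2c h2d h3a,
    omega3g_of_2a_2b_3c h2a h2b h3c, omega3h_of_2c_2d_3d h2c h2d h3d]

theorem isGeneratingSet_of_3a {S : Set Move}
    (h1 : omega1a ∈ S ∧ (omega1b ∈ S ∨ omega1c ∈ S) ∨ omega1b ∈ S ∧ omega1d ∈ S)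
    (h2 : omega2a ∈ S ∨ omega2b ∈ S) (h3 : omega3a ∈ S) : IsGeneratingSet S := by
  have h3a := Derivable.of_mem h3
  have h2 := h2.imp Derivable.of_mem Derivable.of_mem
  have h1 : Derivable S omega1a ∧ (Derivable S omega1b ∨ Derivable S omega1c) := by
    rcases h1 with ⟨h1a, h1⟩ | ⟨h1b, h1d⟩
    · exact ⟨.of_mem h1a, h1.imp .of_mem .of_mem⟩
    -- The pair Ω1b, Ω1d lacks Ω1a, which is derived first from whichever parallel type 2 move is
    -- present.
    · exact ⟨h2.elim (omega1a_of_1b_1d_2a_3a (.of_mem h1b) (.of_mem h1d) · h3a)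
        (omega1a_of_1b_1d_2b_3a (.of_mem h1b) (.of_mem h1d) · h3a), .inl (.of_mem h1b)⟩
  have h := types12_of_3a h1.1 h1.2 h2 h3a
  exact isGeneratingSet_of_types12 ⟨h1.1, h.1⟩ h.2 h3a

theorem isGeneratingSet_of_3h {S : Set Move}
    (h1 : omega1c ∈ S ∧ (omega1d ∈ S ∨ omega1a ∈ S) ∨ omega1d ∈ S ∧ omega1b ∈ S)
    (h2 : omega2a ∈ S ∨ omega2b ∈ S) (h3 : omega3h ∈ S) : IsGeneratingSet S := by
  have h3h := Derivable.of_mem h3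
  have h2 := h2.imp Derivable.of_mem Derivable.of_mem
  have h1 : Derivable S omega1c ∧ (Derivable S omega1d ∨ Derivable S omega1a) := by
    rcases h1 with ⟨h1c, h1⟩ | ⟨h1d, h1b⟩
    · exact ⟨.of_mem h1c, h1.imp .of_mem .of_mem⟩
    · exact ⟨h2.elim (omega1c_of_1b_1d_2a_3h (.of_mem h1b) (.of_mem h1d) · h3h)
        (omega1c_of_1b_1d_2b_3h (.of_mem h1b) (.of_mem h1d) · h3h), .inl (.of_mem h1d)⟩
  obtain ⟨⟨h1a, h1b, h1d⟩, h2a, h2b, h2c, h2d⟩ := types12_of_3h h1.1 h1.2 h2 h3h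
  -- The path Ω3h, Ω3d, Ω3b, Ω3a in the cube, along which one sign changes at a time, leads back to
  -- the case with Ω3a.
  have h3d := omega3d_of_2c_2d_3h h2c h2d h3h
  have h3b := omega3b_of_2a_2b_3d h2a h2b h3d
  exact isGeneratingSet_of_types12 ⟨h1a, h1b, h1.1, h1d⟩ ⟨h2a, h2b, h2c, h2d⟩
    (omega3a_of_2c_2d_3b h2c h2d h3b)

end Reidemeister

theorem theorem2 (S : Set Reidemeister.Move)
    (hS : S ∈ Reidemeister.collectionA ∪ Reidemeister.collectionH) :
    Reidemeister.IsGeneratingSet S := by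
  rcases hS with h | h
  · refine Reidemeister.isGeneratingSet_of_3a ?_ ?_ ?_ <;>
      rcases h with rfl | rfl | rfl | rfl | rfl | rfl <;> simp
  · refine Reidemeister.isGeneratingSet_of_3h ?_ ?_ ?_ <;>
      rcases h with rfl | rfl | rfl | rfl | rfl | rfl <;> simp
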